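/- Let $\mathbb{H}^1=(\mathbb{R}^3,\cdot)$ be the first Heisenberg group, with product $(x,y,t)\cdot(x',y',t')=(x+x',\,y+y',\,t+t'+\tfrac12(xy'-yx'))$, Korányi norm $\|(x,y,t)\|=((x^2+y^2)^2+16t^2)^{1/4}$ and metric $d_{\mathbb{H}}(p,q)=\|q^{-1}\cdot p\|$. Balls $B(p,r)$ (open) and Hausdorff measures $\mathcal{H}^3$ in $\mathbb{H}^1$ refer to $d_{\mathbb{H}}$. Let $\Pi=\mathbb{R}^2$ be the parabolic plane, with metric $d_\Pi(v,w)=\|v-w\|$, where $\|(y,t)\|=(y^4+16t^2)^{1/4}$. Put $\mathbb{W}=\{x=0\}\cong\mathbb{R}^2$ and $\mathbb{V}=\{(x,0,0)\}\cong\mathbb{R}$, and let $\pi_{\mathbb{W}},\pi_{\mathbb{V}}$ be the projections determined by $p=\pi_{\mathbb{W}}(p)\cdot\pi_{\mathbb{V}}(p)$, with $\pi_{\mathbb{W}}(p)\in\mathbb{W}$, $\pi_{\mathbb{V}}(p)\in\mathbb{V}$. A function $\varphi:\mathbb{W}\to\mathbb{V}$ is intrinsic Lipschitz if there is $L>0$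 such that its intrinsic graph $S=\{w\cdot\varphi(w):w\in\mathbb{W}\}$ satisfies $S\cap(p\cdot\mathcal{C}(a))=\{p\}$ for all $p\in S$ and $0<a<L^{-1}$, where $\mathcal{C}(a)=\{q:\|\pi_{\mathbb{W}}(q)\|\le a\|\pi_{\mathbb{V}}(q)\|\}$. **Theorem.** Let $\varphi:\mathbb{W}\to\mathbb{V}$ be a compactly supported intrinsic Lipschitz function with extra vertical Hölder regularity, that is, for some $0<\alpha\le1$ and $H>0$, $$|\varphi(y,t)-\varphi(y,t')|\le H|t-t'|^{(1+\alpha)/2}\qquad\text{for all } y,t,t'\in\mathbb{R}.$$ Then the intrinsic graph $S$ of $\varphi$ has big pieces of bilipschitz images of the parabolic plane: $S$ is closed and $3$-regular (there is $C\ge1$ with $C^{-1}r^3\le\mathcal{H}^3(S\cap B(p,r))\le Cr^3$ for all $p\in S$ and $0<r\le\operatorname{diam}S$), and there are constants $\Lambda\ge1$ and $\theta>0$ such that for every $p\in S$ and $0<r\le\operatorname{diam}S$ there exist a compact set $K\subset B(0,r)\subset\Pi$ and a $\Lambda$-bilipschitz map $f:K\to\mathbb{H}^1$ with $$\mathcal{H}^3\big(f(K)\cap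 S\cap B(p,r)\big)\ge\theta r^3 .$$ In particular, $S$ is LI rectifiable: $S$ is $\mathcal{H}^3$-measurable, and $\mathcal{H}^3$ almost all of $S$ is covered by countably many Lipschitz images (in $\mathbb{H}^1$) of closed subsets of vertical subgroups, i.e. of two-dimensional linear subspaces of $\mathbb{R}^3$ containing the $t$-axis. -/

import Mathlib

open MeasureTheory Set
open scoped ENNReal NNReal

/-- The first Heisenberg group `ℍ¹`, as a set `ℝ³` with coordinates `(x, y, t)`. -/
@[ext]
structure Heis where
  x : ℝ
  y : ℝ
  t : ℝ

namespace Heis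

noncomputable instance : Mul Heis :=
  ⟨fun p q => ⟨p.x + q.x, p.y + q.y, p.t + q.t + (p.x * q.y - p.y * q.x) / 2⟩⟩

instance : One Heis := ⟨⟨0, 0, 0⟩⟩

instance : Inv Heis := ⟨fun p => ⟨-p.x, -p.y, -p.t⟩⟩

@[simp] theorem mul_x (p q : Heis) : (p * q).x = p.x + q.x := rfl
@[simp] theorem mul_y (p q : Heis) : (p * q).y = p.y + q.y := rfl
@[simp] theorem mul_t (p q : Heis) :
    (p * q).t = p.t + q.t + (p.x * q.y - p.y * q.x) / 2 := rfl
@[simp] theorem one_x : (1 : Heis).x = 0 := rfl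
@[simp] theorem one_y : (1 : Heis).y = 0 := rfl
@[simp] theorem one_t : (1 : Heis).t = 0 := rfl
@[simp] theorem inv_x (p : Heis) : p⁻¹.x = -p.x := rfl
@[simp] theorem inv_y (p : Heis) : p⁻¹.y = -p.y := rfl
@[simp] theorem inv_t (p : Heis) : p⁻¹.t = -p.t := rfl

/-- The Heisenberg group structure. -/
noncomputable instance : Group Heis :=
  Group.ofLeftAxioms
    (fun p q r => by ext <;> simp <;> ring)
    (fun p => by ext <;> simp)
    (fun p => by ext <;> simp; ring)

/-- The Korányi norm `‖(x, y, t)‖ = ((x² + y²)² + 16 t²)^{1/4}`. -/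
noncomputable def koranyi (p : Heis) : ℝ :=
  ((p.x ^ 2 + p.y ^ 2) ^ 2 + 16 * p.t ^ 2) ^ (1 / 4 : ℝ)

theorem koranyi_nonneg (p : Heis) : 0 ≤ p.koranyi := by
  unfold koranyi; positivity

theorem koranyi_pow_four (p : Heis) :
    p.koranyi ^ 4 = (p.x ^ 2 + p.y ^ 2) ^ 2 + 16 * p.t ^ 2 := by
  unfold koranyi
  rw [← Real.rpow_natCast, ← Real.rpow_mul (by positivity)]
  norm_num

theorem koranyi_one : koranyi 1 = 0 := by
  simp [koranyi]

theorem koranyi_inv (p : Heis) : p⁻¹.koranyi = p.koranyi := by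
  simp [koranyi]

theorem eq_one_of_koranyi_eq_zero {p : Heis} (h : p.koranyi = 0) : p = 1 := by
  have h4 := p.koranyi_pow_four
  rw [h] at h4
  have ht : p.t = 0 := by nlinarith [sq_nonneg (p.x ^ 2 + p.y ^ 2), sq_nonneg p.t]
  have hxy : p.x ^ 2 + p.y ^ 2 = 0 := by
    rw [ht] at h4; nlinarith [sq_nonneg (p.x ^ 2 + p.y ^ 2)]
  ext
  · simp only [one_x]; nlinarith [sq_nonneg p.x, sq_nonneg p.y]
  · simp only [one_y]; nlinarith [sq_nonneg p.x, sq_nonneg p.y]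
  · exact ht

theorem koranyi_mul_le (p q : Heis) : (p * q).koranyi ≤ p.koranyi + q.koranyi := by
  -- Embed `p` as the complex number `|z|² + 4 i t`, whose modulus is the square of the norm.
  let Z : Heis → ℂ := fun p => ⟨p.x ^ 2 + p.y ^ 2, 4 * p.t⟩
  have hZ : ∀ p : Heis, ‖Z p‖ = p.koranyi ^ 2 := fun p => by
    rw [← abs_of_nonneg (norm_nonneg (Z p)), ← abs_of_nonneg (sq_nonneg p.koranyi),
      ← sq_eq_sq_iff_abs_eq_abs, ← Complex.normSq_eq_norm_sq, Complex.normSq_apply]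
    have := p.koranyi_pow_four
    simp only [Z]
    nlinarith
  let W : ℂ := ⟨2 * (p.x * q.x + p.y * q.y), 2 * (p.x * q.y - p.y * q.x)⟩
  have hsum : Z (p * q) = Z p + Z q + W := by
    apply Complex.ext <;> simp [Z, W] <;> ring
  have hxy : ∀ p : Heis, p.x ^ 2 + p.y ^ 2 ≤ p.koranyi ^ 2 := fun p => by
    have := p.koranyi_pow_four
    exact (abs_le_of_sq_le_sq' (by nlinarith [sq_nonneg p.t]) (sq_nonneg _)).2
  have hW : ‖W‖ ≤ 2 * (p.koranyi * q.koranyi) := by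
    have hpq : 0 ≤ p.koranyi * q.koranyi := mul_nonneg p.koranyi_nonneg q.koranyi_nonneg
    refine (abs_le_of_sq_le_sq' ?_ (by positivity)).2
    rw [← Complex.normSq_eq_norm_sq, Complex.normSq_apply]
    have := mul_le_mul (hxy p) (hxy q) (by positivity) (sq_nonneg _)
    simp only [W]
    nlinarith
  have h1 : (p * q).koranyi ^ 2 ≤ (p.koranyi + q.koranyi) ^ 2 := by
    rw [← hZ, hsum]
    have := norm_add₃_le (a := Z p) (b := Z q) (c := W)
    rw [hZ, hZ] at this
    nlinarith
  exact (abs_le_of_sq_le_sq' h1 (add_nonneg p.koranyi_nonneg q.koranyi_nonneg)).2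

/-- The Korányi metric `d(p, q) = ‖q⁻¹ · p‖`; all metric notions in `ℍ¹` refer to it. -/
noncomputable instance : MetricSpace Heis where
  dist p q := koranyi (q⁻¹ * p)
  dist_self p := by simp [koranyi_one]
  dist_comm p q := by
    rw [← koranyi_inv]; simp
  dist_triangle p q r := by
    have h : r⁻¹ * p = (r⁻¹ * q) * (q⁻¹ * p) := by group
    rw [h, add_comm]
    exact koranyi_mul_le _ _
  eq_of_dist_eq_zero {p q} h := by
    have := eq_one_of_koranyi_eq_zero h
    rw [inv_mul_eq_one] at this
    exact this.symm

theorem dist_eq (p q : Heis) : dist p q = koranyi (q⁻¹ * p) := rfl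

noncomputable instance : MeasurableSpace Heis := borel Heis

instance : BorelSpace Heis := ⟨rfl⟩

/-- The vertical projection to `𝕎 = {x = 0}` along the splitting `ℍ¹ = 𝕎 · 𝕍`. -/
noncomputable def projW (p : Heis) : Heis := ⟨0, p.y, p.t + p.x * p.y / 2⟩

/-- The horizontal projection to `𝕍 = {(x, 0, 0)}` along the splitting `ℍ¹ = 𝕎 · 𝕍`. -/
def projV (p : Heis) : Heis := ⟨p.x, 0, 0⟩

theorem projW_mul_projV (p : Heis) : p.projW * p.projV = p := by
  ext <;> simp [projW, projV]; ring

/-- The cone `𝒞(a) = {q : ‖π_𝕎(q)‖ ≤ a ‖π_𝕍(q)‖}`. -/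
def cone (a : ℝ) : Set Heis := {q | q.projW.koranyi ≤ a * q.projV.koranyi}

/-- The graph map `Φ(w) = w · φ(w)`, where `(y, t) ∈ ℝ²` stands for `(0, y, t) ∈ 𝕎` and `x ∈ ℝ`
for `(x, 0, 0) ∈ 𝕍`. -/
noncomputable def graphMap (φ : ℝ × ℝ → ℝ) (w : ℝ × ℝ) : Heis :=
  (⟨0, w.1, w.2⟩ : Heis) * ⟨φ w, 0, 0⟩

/-- The intrinsic graph `Φ(𝕎)` of a globally defined function `φ : 𝕎 → 𝕍`. -/
def intrinsicGraph (φ : ℝ × ℝ → ℝ) : Set Heis := range (graphMap φ)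

/-- `φ` is an intrinsic `L`-Lipschitz function: its intrinsic graph `S` satisfies
`S ∩ (p · 𝒞(a)) = {p}` for all `p ∈ S` and `0 < a < L⁻¹`. -/
def IsIntrinsicLipschitzWith (L : ℝ) (φ : ℝ × ℝ → ℝ) : Prop :=
  ∀ p ∈ intrinsicGraph φ, ∀ a : ℝ, 0 < a → a < L⁻¹ →
    intrinsicGraph φ ∩ (fun q => p * q) '' cone a = {p}

/-- `φ` is an intrinsic Lipschitz function. -/
def IsIntrinsicLipschitz (φ : ℝ × ℝ → ℝ) : Prop :=
  ∃ L : ℝ, 0 < L ∧ IsIntrinsicLipschitzWith L φ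

/-- The vertical Hölder condition `|φ(y,t) - φ(y,t')| ≤ H |t - t'|^{(1+α)/2}`. -/
def HasExtraVerticalHolder (φ : ℝ × ℝ → ℝ) (α H : ℝ) : Prop :=
  ∀ y t t' : ℝ, |φ (y, t) - φ (y, t')| ≤ H * |t - t'| ^ ((1 + α) / 2)

/-- `W` is a vertical subgroup of codimension `1`: a `2`-dimensional linear subspace of `ℝ³`
containing the `t`-axis. -/
def IsVerticalSubgroup (W : Set Heis) : Prop :=
  ∃ a b : ℝ, (a ≠ 0 ∨ b ≠ 0) ∧ W = {p | a * p.x + b * p.y = 0}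

/-- `E` is (Ahlfors) `3`-regular. -/
def IsThreeRegular (E : Set Heis) : Prop :=
  ∃ C : ℝ, 1 ≤ C ∧ ∀ p ∈ E, ∀ r : ℝ, 0 < r → ENNReal.ofReal r ≤ Metric.ediam E →
    ENNReal.ofReal (C⁻¹ * r ^ 3) ≤ μH[3] (E ∩ Metric.ball p r) ∧
    μH[3] (E ∩ Metric.ball p r) ≤ ENNReal.ofReal (C * r ^ 3)

/-- `E` is Lipschitz image rectifiable: it is `ℋ³`-measurable, and `ℋ³` almost all of `E` can be
covered by countably many Lipschitz images of closed subsets of vertical subgroups. -/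
def IsLIRectifiable (E : Set Heis) : Prop :=
  (μH[3] : Measure Heis).toOuterMeasure.IsCaratheodory E ∧
  ∃ (K : ℕ → Set Heis) (f : ℕ → Heis → Heis),
    (∀ i, IsClosed (K i) ∧ (∃ W, IsVerticalSubgroup W ∧ K i ⊆ W) ∧
      ∃ C : ℝ≥0, LipschitzOnWith C (f i) (K i)) ∧
    μH[3] (E \ ⋃ i, f i '' K i) = 0

end Heis

/-- The parabolic plane `Π`, as a set `ℝ²` with coordinates `(y, t)`. -/
@[ext]
structure ParabolicPlane where
  y : ℝ
  t : ℝ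

namespace ParabolicPlane

instance : Zero ParabolicPlane := ⟨⟨0, 0⟩⟩

instance : Sub ParabolicPlane := ⟨fun v w => ⟨v.y - w.y, v.t - w.t⟩⟩

/-- The norm `‖(y, t)‖ = (y⁴ + 16 t²)^{1/4}` of the parabolic plane. -/
noncomputable def parabolicNorm (v : ParabolicPlane) : ℝ :=
  (v.y ^ 4 + 16 * v.t ^ 2) ^ (1 / 4 : ℝ)

/-- The inclusion `(y, t) ↦ (0, y, t)` of the parabolic plane into `ℍ¹`. -/
def toHeis (v : ParabolicPlane) : Heis := ⟨0, v.y, v.t⟩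

theorem parabolicNorm_sub (v w : ParabolicPlane) :
    (v - w).parabolicNorm = dist v.toHeis w.toHeis := by
  have hy : (v - w).y = v.y - w.y := rfl
  have ht : (v - w).t = v.t - w.t := rfl
  simp only [parabolicNorm, Heis.dist_eq, Heis.koranyi, toHeis, hy, ht, Heis.mul_x, Heis.mul_y,
    Heis.mul_t, Heis.inv_x, Heis.inv_y, Heis.inv_t]
  congr 1
  ring

/-- The metric `d_Π(v, w) = ‖v - w‖`. -/
noncomputable instance : MetricSpace ParabolicPlane where
  dist v w := (v - w).parabolicNorm
  dist_self v := by simp only [parabolicNorm_sub, dist_self]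
  dist_comm v w := by simp only [parabolicNorm_sub, dist_comm]
  dist_triangle u v w := by simp only [parabolicNorm_sub]; exact dist_triangle _ _ _
  eq_of_dist_eq_zero {v w} h := by
    rw [parabolicNorm_sub] at h
    have h' := eq_of_dist_eq_zero h
    simp only [toHeis, Heis.mk.injEq, true_and] at h'
    exact ParabolicPlane.ext h'.1 h'.2

end ParabolicPlane

/-- `f` is `L`-bilipschitz on the set `K ⊆ Π`. -/
def IsBilipschitzOn (L : ℝ) (f : ParabolicPlane → Heis) (K : Set ParabolicPlane) : Prop :=
  ∀ v ∈ K, ∀ w ∈ K, L⁻¹ * dist v w ≤ dist (f v) (f w) ∧ dist (f v) (f w) ≤ L * dist v w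

/-- The set `E ⊆ ℍ¹` is closed and `3`-regular, and has big pieces of bilipschitz images of the
parabolic plane. -/
def HasBigPiecesOfBilipschitzImages (E : Set Heis) : Prop :=
  IsClosed E ∧ Heis.IsThreeRegular E ∧
  ∃ L θ : ℝ, 1 ≤ L ∧ 0 < θ ∧
    ∀ p ∈ E, ∀ r : ℝ, 0 < r → ENNReal.ofReal r ≤ Metric.ediam E →
      ∃ (K : Set ParabolicPlane) (f : ParabolicPlane → Heis),
        IsCompact K ∧ K ⊆ Metric.ball 0 r ∧ IsBilipschitzOn L f K ∧
        ENNReal.ofReal (θ * r ^ 3) ≤ μH[3] (f '' K ∩ (E ∩ Metric.ball p r))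

open Filter Topology

/-! Write `Φ` for the graph map and `w = (y, t)`, `w' = (y', t')`. On an intrinsic Lipschitz graph
the distance from `Φ w` to `Φ w'` is comparable to the parabolic norm of `(y - y', t - t' - φ w' (y
- y'))` (`slopeDist_le_two_mul_dist`, `dist_graphMap_le`). Hence `(y, τ) ↦ Φ (y, T y τ)` is
bilipschitz as soon as `T y τ - T y' τ' - φ (y', T y' τ') (y - y')` equals `τ - τ'` up to a multiple
of `(y - y')²` plus `|τ - τ'| / 2` (`koranyi_comparison`). The curves `y ↦ T y τ` should thus be
nearly characteristic, with slope `φ`, and spaced vertically like `τ`. Characteristic curves of a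
merely Hölder `φ` may merge or spread, so such a `T` is sought only on a large subset of a
rectangle.

Cut the `(y, τ)` rectangle into nested parabolic cells of size `r × r²`, `r = s / 2 ^ n`. In a cell,
vertical translates of one approximate characteristic arc serve for all points; passing to a subcell
changes the arc, at a cost of `r` times the oscillation of `φ` on vertical segments of length about
`r²`. The extra Hölder exponent makes this cost a small multiple of `q ^ (2 n) r²`, with `q = 2 ^
(-α / 2) < 1`. So the corrections converge, and they are harmless for two points first separated at
level `n + 1` if these stay away from cell boundaries by the relative margin `κ q ^ n`
(`CellsShrinkTo.abs_sub_le`, `exists_height_cantorCore`). Since `∑ q ^ n` converges, a product of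
two Cantor sets of positive measure has all these margins (`le_volume_cantorCore`).

This gives big pieces at small scales; at large scales compact support makes the graph a vertical
plane on most of a ball, and intermediate scales borrow the largest small one
(`exists_hasBigPiece`). Big pieces also yield lower regularity, and counting a cover yields upper
regularity. LI rectifiability follows by a density argument: a fixed proportion of each ball around
a dense set of centers is covered by charts, so the uncovered set cannot have density points. -/

/-! ### Approximate characteristic curves. -/

/-- The pointwise form of the intrinsic Lipschitz condition. -/
def IntrinsicBound (L : ℝ) (φ : ℝ × ℝ → ℝ) : Prop :=
  ∀ y t y' t' : ℝ,
    |φ (y, t) - φ (y', t')| ≤ L * (|y - y'| + √|t - t' - φ (y', t') * (y - y')|)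

/-- The line through `(a, b)` with slope `φ (a, b)`. -/
def charLine (φ : ℝ × ℝ → ℝ) (a b s : ℝ) : ℝ := b + φ (a, b) * (s - a)

/-- The first Picard iterate, from `charLine`, of the characteristic curve through `(a, b)`. -/
noncomputable def charArc (φ : ℝ × ℝ → ℝ) (a b y : ℝ) : ℝ :=
  b + ∫ s in a..y, φ (s, charLine φ a b s)

namespace IntrinsicBound

variable {L : ℝ} {φ : ℝ × ℝ → ℝ}

theorem continuous (h : IntrinsicBound L φ) : Continuous φ := by
  rw [continuous_iff_continuousAt]
  rintro ⟨y', t'⟩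
  rw [ContinuousAt, tendsto_iff_dist_tendsto_zero]
  have hlim : Tendsto (fun w : ℝ × ℝ =>
      L * (|w.1 - y'| + √|w.2 - t' - φ (y', t') * (w.1 - y')|)) (𝓝 (y', t')) (𝓝 0) := by
    have hc : Continuous (fun w : ℝ × ℝ =>
      L * (|w.1 - y'| + √|w.2 - t' - φ (y', t') * (w.1 - y')|)) := by fun_prop
    have := hc.tendsto (y', t')
    simpa using this
  exact squeeze_zero (fun _ => dist_nonneg) (fun w => by
    rw [Real.dist_eq]; exact h w.1 w.2 y' t') hlim

theorem translate (h : IntrinsicBound L φ) (a b : ℝ) :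
    IntrinsicBound L (fun w => φ (a + w.1, b + w.2)) := by
  intro y t y' t'
  have := h (a + y) (b + t) (a + y') (b + t')
  simpa only [add_sub_add_left_eq_sub] using this

theorem abs_sub_charLine (h : IntrinsicBound L φ) (a b s : ℝ) :
    |φ (s, charLine φ a b s) - φ (a, b)| ≤ L * |s - a| := by
  have := h s (charLine φ a b s) a b
  simpa [charLine] using this

theorem continuous_charLine (h : IntrinsicBound L φ) (a b : ℝ) :
    Continuous (fun s => φ (s, charLine φ a b s)) :=
  h.continuous.comp (by unfold charLine; fun_prop)

theorem charArc_sub_charArc (h : IntrinsicBound L φ) (a b y y' : ℝ) :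
    charArc φ a b y - charArc φ a b y' = ∫ s in y'..y, φ (s, charLine φ a b s) := by
  have hi : ∀ u v, IntervalIntegrable (fun s => φ (s, charLine φ a b s)) volume u v :=
    fun u v => (h.continuous_charLine a b).intervalIntegrable u v
  simp only [charArc]
  rw [add_sub_add_left_eq_sub, intervalIntegral.integral_interval_sub_left (hi _ _) (hi _ _)]

/-- Along the line through a point with the slope there, the square root in `IntrinsicBound`
vanishes, so `φ` is Lipschitz along that line as seen from its base point; integrate. -/
theorem abs_charArc_sub_charLine (h : IntrinsicBound L φ) (hL : 0 ≤ L) (a b y : ℝ) :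
    |charArc φ a b y - charLine φ a b y| ≤ L * (y - a) ^ 2 := by
  have hi := (h.continuous_charLine a b).intervalIntegrable (μ := volume) a y
  have e : charArc φ a b y - charLine φ a b y
      = ∫ s in a..y, (φ (s, charLine φ a b s) - φ (a, b)) := by
    rw [intervalIntegral.integral_sub hi intervalIntegrable_const]
    simp [charArc, charLine]; ring
  rw [e, ← Real.norm_eq_abs]
  refine (intervalIntegral.norm_integral_le_of_norm_le_const (C := L * |y - a|) ?_).trans ?_
  · intro s hs
    rw [Real.norm_eq_abs]
    refine (h.abs_sub_charLine a b s).trans (mul_le_mul_of_nonneg_left ?_ hL)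
    exact abs_sub_left_of_mem_uIcc (uIoc_subset_uIcc hs)
  · rw [mul_assoc, abs_mul_abs_self]; nlinarith

/-- The vertical size of the region met by the characteristic lines of a cell. -/
noncomputable def spread (L : ℝ) : ℝ := (L + 2) + 2 * (L * (1 + √(L + 2)))

/-- Height offset of order `r²` forces the slopes to differ by order `r`, which over a length `2 r`
costs again order `r²`. This fixes the vertical range on which oscillation of `φ` has to be
controlled. -/
theorem abs_charLine_sub_charLine (h : IntrinsicBound L φ) (hL : 0 ≤ L) {a b y' t' s r : ℝ}
    (hr : 0 ≤ r) (hy' : |y' - a| ≤ r) (ht' : |t' - charLine φ a b y'| ≤ (L + 2) * r ^ 2)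
    (hs : |s - a| ≤ r) :
    |charLine φ y' t' s - charLine φ a b s| ≤ spread L * r ^ 2 := by
  have h1 : |φ (y', t') - φ (a, b)| ≤ L * (1 + √(L + 2)) * r := by
    have h2 := h y' t' a b
    have h3 : t' - b - φ (a, b) * (y' - a) = t' - charLine φ a b y' := by
      simp [charLine]; ring
    rw [h3] at h2
    have h4 : √|t' - charLine φ a b y'| ≤ √(L + 2) * r := by
      calc _ ≤ √((L + 2) * r ^ 2) := Real.sqrt_le_sqrt ht'
        _ = _ := by rw [Real.sqrt_mul (by linarith), Real.sqrt_sq hr]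
    calc _ ≤ _ := h2
      _ ≤ L * (r + √(L + 2) * r) := by gcongr
      _ = _ := by ring
  have h5 : |s - y'| ≤ 2 * r := by
    have := abs_sub_le s a y'
    rw [abs_sub_comm a y'] at this; linarith
  have e : charLine φ y' t' s - charLine φ a b s
      = (t' - charLine φ a b y') + (φ (y', t') - φ (a, b)) * (s - y') := by
    simp [charLine]; ring
  rw [e]
  refine (abs_add_le _ _).trans ?_
  rw [abs_mul]
  have h6 : |φ (y', t') - φ (a, b)| * |s - y'| ≤ L * (1 + √(L + 2)) * r * (2 * r) := by gcongr
  unfold spread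
  nlinarith

/-- Along the characteristic arc of a cell, the increments at a point of the cell are those
prescribed by the slope there, up to a quadratic error. -/
theorem abs_integral_charLine_sub (h : IntrinsicBound L φ) (hL : 0 ≤ L) {a b y y' t' r P : ℝ}
    (hr : 0 ≤ r)
    (hv : ∀ s t t', |t - t'| ≤ spread L * r ^ 2 → |φ (s, t) - φ (s, t')| ≤ P)
    (hy : |y - a| ≤ r) (hy' : |y' - a| ≤ r) (ht' : |t' - charLine φ a b y'| ≤ (L + 2) * r ^ 2) :
    |(charArc φ a b y - charArc φ a b y') - φ (y', t') * (y - y')|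
      ≤ L * (y - y') ^ 2 + P * |y - y'| := by
  have hi := (h.continuous_charLine a b).intervalIntegrable (μ := volume) y' y
  have e : (∫ s in y'..y, φ (s, charLine φ a b s)) - φ (y', t') * (y - y')
      = ∫ s in y'..y, (φ (s, charLine φ a b s) - φ (y', t')) := by
    rw [intervalIntegral.integral_sub hi intervalIntegrable_const]
    simp; ring
  rw [h.charArc_sub_charArc, e, ← Real.norm_eq_abs]
  refine (intervalIntegral.norm_integral_le_of_norm_le_const (C := P + L * |y - y'|) ?_).trans ?_
  · intro s hs
    have hs' := uIoc_subset_uIcc hs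
    have hsa : |s - a| ≤ r := by
      rw [abs_le] at hy hy' ⊢
      rcases mem_uIcc.1 hs' with h1 | h1 <;> constructor <;> linarith [h1.1, h1.2]
    -- Pass vertically to the line through `(y', t')`, which costs `P`, and then along that line,
    -- which costs a Lipschitz term.
    have h1 := hv s _ _ (h.abs_charLine_sub_charLine hL hr hy' ht' hsa)
    have h2 := h.abs_sub_charLine y' t' s
    have h3 : |s - y'| ≤ |y - y'| := abs_sub_left_of_mem_uIcc hs'
    have h4 := mul_le_mul_of_nonneg_left h3 hL
    rw [Real.norm_eq_abs]
    have h5 := abs_sub_le (φ (s, charLine φ a b s)) (φ (s, charLine φ y' t' s)) (φ (y', t'))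
    rw [abs_sub_comm (φ (s, charLine φ a b s)) (φ (s, charLine φ y' t' s))] at h5
    linarith
  · rw [add_mul, mul_assoc L, abs_mul_abs_self]; nlinarith

/-- The characteristic arc through a point of a cell is nearly parallel to that of the cell. -/
theorem abs_charArc_sub_charArc_sub (h : IntrinsicBound L φ) (hL : 0 ≤ L) {a b y y' t' r P : ℝ}
    (hr : 0 ≤ r)
    (hv : ∀ s t t', |t - t'| ≤ spread L * r ^ 2 → |φ (s, t) - φ (s, t')| ≤ P)
    (hy : |y - a| ≤ r) (hy' : |y' - a| ≤ r) (ht' : |t' - charLine φ a b y'| ≤ (L + 2) * r ^ 2) :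
    |(charArc φ y' t' y - t') - (charArc φ a b y - charArc φ a b y')| ≤ P * |y - y'| := by
  have e : (charArc φ y' t' y - t') - (charArc φ a b y - charArc φ a b y')
      = ∫ s in y'..y, (φ (s, charLine φ y' t' s) - φ (s, charLine φ a b s)) := by
    rw [intervalIntegral.integral_sub ((h.continuous_charLine _ _).intervalIntegrable _ _)
      ((h.continuous_charLine _ _).intervalIntegrable _ _), h.charArc_sub_charArc]
    simp [charArc]
  rw [e, ← Real.norm_eq_abs]
  refine intervalIntegral.norm_integral_le_of_norm_le_const ?_
  intro s hs
  have hs' := uIoc_subset_uIcc hs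
  have hsa : |s - a| ≤ r := by
    rw [abs_le] at hy hy' ⊢
    rcases mem_uIcc.1 hs' with h1 | h1 <;> constructor <;> linarith [h1.1, h1.2]
  exact hv s _ _ (h.abs_charLine_sub_charLine hL hr hy' ht' hsa)

end IntrinsicBound

/-! ### Grids and Cantor sets of large measure. -/

/-- The point of the grid `s ℤ` nearest to `x`. -/
noncomputable def gridPoint (s x : ℝ) : ℝ := s * round (x / s)

theorem abs_sub_gridPoint {s : ℝ} (hs : 0 < s) (x : ℝ) : |x - gridPoint s x| ≤ s / 2 := by
  have e : x - gridPoint s x = s * (x / s - round (x / s)) := by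
    unfold gridPoint; field_simp
  rw [e, abs_mul, abs_of_pos hs]
  have := abs_sub_round (x / s)
  nlinarith

theorem gridPoint_eq_zero {s x : ℝ} (hs : 0 < s) (hx : |x| ≤ s / 4) : gridPoint s x = 0 := by
  have h0 : round (x / s) = 0 := by
    rw [round_eq_zero_iff]
    rw [abs_le] at hx
    constructor
    · rw [le_div_iff₀ hs]; linarith
    · rw [div_lt_iff₀ hs]; linarith
  simp [gridPoint, h0]

/-- Points which avoid the boundaries of the grid cells and lie in distinct cells are
separated. -/
theorem le_abs_sub_of_gridPoint_ne {s ε x x' : ℝ} (hs : 0 < s)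
    (hx : |x / s - round (x / s)| ≤ 1 / 2 - ε) (hx' : |x' / s - round (x' / s)| ≤ 1 / 2 - ε)
    (hne : gridPoint s x ≠ gridPoint s x') : 2 * ε * s ≤ |x - x'| := by
  have hr : round (x / s) ≠ round (x' / s) := fun h => hne (by simp [gridPoint, h])
  have h1 : (1 : ℝ) ≤ |(round (x / s) : ℝ) - round (x' / s)| := by
    exact_mod_cast Int.one_le_abs (sub_ne_zero.2 hr)
  have h2 : 2 * ε ≤ |x / s - x' / s| := by
    have e : (round (x / s) : ℝ) - round (x' / s)
        = -(x / s - round (x / s)) + (x / s - x' / s) + (x' / s - round (x' / s)) := by ring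
    rw [e] at h1
    have := abs_add_three (-(x / s - round (x / s))) (x / s - x' / s) (x' / s - round (x' / s))
    rw [abs_neg] at this
    linarith
  rw [← sub_div, abs_div, abs_of_pos hs, le_div_iff₀ hs] at h2
  exact h2

/-- The points of `[-S/4, S/4]` which, for every `n`, avoid the boundaries of the cells of side
`S / M ^ (n + 1)`, with relative margin `κ q ^ n`. -/
def cantorCore (S M κ q : ℝ) : Set ℝ :=
  {x | |x| ≤ S / 4 ∧ ∀ n : ℕ,
    |x / (S / M ^ (n + 1)) - round (x / (S / M ^ (n + 1)))| ≤ 1 / 2 - κ * q ^ n}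

/-- Although `round` jumps, this is the distance to the integers, that is, the norm on the circle `ℝ
/ ℤ`. -/
theorem continuous_abs_sub_round : Continuous (fun x : ℝ => |x - round x|) := by
  have : (fun x : ℝ => |x - round x|) = fun x : ℝ => ‖(x : AddCircle (1 : ℝ))‖ := by
    ext x; rw [AddCircle.norm_eq]; simp
  rw [this]
  exact continuous_norm.comp (AddCircle.continuous_mk' 1)

theorem isClosed_cantorCore (S M κ q : ℝ) : IsClosed (cantorCore S M κ q) := by
  have : cantorCore S M κ q = {x | |x| ≤ S / 4} ∩ ⋂ n : ℕ, {x |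
      |x / (S / M ^ (n + 1)) - round (x / (S / M ^ (n + 1)))| ≤ 1 / 2 - κ * q ^ n} := by
    ext x; simp [cantorCore]
  rw [this]
  refine (isClosed_le continuous_abs continuous_const).inter (isClosed_iInter fun n => ?_)
  exact isClosed_le (continuous_abs_sub_round.comp (continuous_id.div_const _)) continuous_const

/-- The set lies in intervals of length `2 ε s` around at most `5 S / s` cell boundaries. -/
theorem volume_grid_margin_le {S s ε : ℝ} (hs : 0 < s) (hsS : s ≤ S) (hε : 0 ≤ ε) :
    volume {x : ℝ | |x| ≤ S / 4 ∧ 1 / 2 - ε < |x / s - round (x / s)|}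
      ≤ ENNReal.ofReal (10 * ε * S) := by
  set m : ℤ := ⌈S / s⌉ with hm
  have hSs : 1 ≤ S / s := by rwa [le_div_iff₀ hs, one_mul]
  have hm1 : (m : ℝ) < S / s + 1 := Int.ceil_lt_add_one _
  have hm2 : S / s ≤ m := Int.le_ceil _
  have hm0 : 0 ≤ m := by
    have : (0 : ℝ) ≤ m := by linarith
    exact_mod_cast this
  have hsub : {x : ℝ | |x| ≤ S / 4 ∧ 1 / 2 - ε < |x / s - round (x / s)|} ⊆
      ⋃ k ∈ Finset.Icc (-m) m, Icc (s * (k + 1 / 2 - ε)) (s * (k + 1 / 2 + ε)) := by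
    rintro x ⟨hx, hx2⟩
    have h1 := abs_sub_round (x / s)
    have hxs : |x / s| ≤ S / s / 4 := by
      rw [abs_div, abs_of_pos hs, div_le_iff₀ hs]
      have : S / s / 4 * s = S / 4 := by field_simp
      rwa [this]
    rw [abs_le] at hxs h1
    have hxx : x = s * (x / s) := by field_simp
    simp only [mem_iUnion, Finset.mem_Icc, exists_prop, mem_Icc]
    rcases le_or_gt 0 (x / s - round (x / s)) with h0 | h0
    · rw [abs_of_nonneg h0] at hx2
      refine ⟨round (x / s), ⟨?_, ?_⟩, ?_, ?_⟩
      · have : (-(m : ℝ)) ≤ round (x / s) := by linarith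
        exact_mod_cast this
      · have : (round (x / s) : ℝ) ≤ m := by linarith
        exact_mod_cast this
      · rw [hxx]; apply mul_le_mul_of_nonneg_left _ hs.le
        rw [← hxx]; linarith
      · rw [hxx]; apply mul_le_mul_of_nonneg_left _ hs.le
        rw [← hxx]; linarith
    · rw [abs_of_neg h0] at hx2
      -- Boundaries are indexed by the cell on their left, so a point near the left end of its cell
      -- uses the preceding index.
      refine ⟨round (x / s) - 1, ⟨?_, ?_⟩, ?_, ?_⟩
      · have : (-(m : ℝ)) - 1 < ((round (x / s) - 1 : ℤ) : ℝ) := by push_cast; linarith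
        have : (-m) - 1 < round (x / s) - 1 := by exact_mod_cast this
        omega
      · have : ((round (x / s) - 1 : ℤ) : ℝ) ≤ m := by push_cast; linarith
        exact_mod_cast this
      · rw [hxx]; apply mul_le_mul_of_nonneg_left _ hs.le
        rw [← hxx]; push_cast; linarith
      · rw [hxx]; apply mul_le_mul_of_nonneg_left _ hs.le
        rw [← hxx]; push_cast; linarith
  refine (measure_mono hsub).trans ((measure_biUnion_finset_le _ _).trans ?_)
  simp only [Real.volume_Icc]
  have e : ∀ k : ℤ, s * ((k : ℝ) + 1 / 2 + ε) - s * (k + 1 / 2 - ε) = 2 * ε * s := by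
    intro k; ring
  simp only [e, Finset.sum_const, Int.card_Icc, nsmul_eq_mul]
  rw [← ENNReal.ofReal_natCast, ← ENNReal.ofReal_mul (by positivity)]
  apply ENNReal.ofReal_le_ofReal
  have hc : (((m + 1 - -m).toNat : ℕ) : ℝ) = 2 * m + 1 := by
    have : (((m + 1 - -m).toNat : ℕ) : ℤ) = 2 * m + 1 := by omega
    exact_mod_cast this
  rw [hc]
  have h5 : (2 * (m : ℝ) + 1) * s ≤ 5 * S := by
    have : S / s * s = S := by field_simp
    nlinarith
  nlinarith

/-- The removed margins sum geometrically to at most `10 κ S / (1 - q) ≤ S / 4`, half the length of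
the starting interval; whence the choice `κ = (1 - q) / 40` later on. -/
theorem le_volume_cantorCore {S M κ q : ℝ} (hS : 0 < S) (hM : 1 ≤ M) (hq : 0 < q) (hq1 : q < 1)
    (hκ : 0 < κ) (hκq : 40 * κ ≤ 1 - q) :
    ENNReal.ofReal (S / 4) ≤ volume (cantorCore S M κ q) := by
  set bad : ℕ → Set ℝ := fun n => {x : ℝ | |x| ≤ S / 4 ∧ 1 / 2 - κ * q ^ n
    < |x / (S / M ^ (n + 1)) - round (x / (S / M ^ (n + 1)))|}
  have hbad : ∀ n, volume (bad n) ≤ ENNReal.ofReal (10 * (κ * q ^ n) * S) := by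
    intro n
    refine volume_grid_margin_le (by positivity) ?_ (by positivity)
    exact div_le_self hS.le (one_le_pow₀ hM)
  have hsum : HasSum (fun n : ℕ => 10 * (κ * q ^ n) * S) (10 * (κ * (1 - q)⁻¹) * S) :=
    (((hasSum_geometric_of_lt_one hq.le hq1).mul_left κ).mul_left 10).mul_right S
  have htot : volume (⋃ n, bad n) ≤ ENNReal.ofReal (S / 4) := by
    refine (measure_iUnion_le _).trans ((ENNReal.tsum_le_tsum hbad).trans ?_)
    rw [← ENNReal.ofReal_tsum_of_nonneg (fun n => by positivity) hsum.summable, hsum.tsum_eq]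
    apply ENNReal.ofReal_le_ofReal
    have : κ * (1 - q)⁻¹ ≤ 1 / 40 := by
      rw [← div_eq_mul_inv, div_le_iff₀ (by linarith)]; linarith
    nlinarith
  have hsub : Icc (-(S / 4)) (S / 4) ⊆ cantorCore S M κ q ∪ ⋃ n, bad n := by
    intro x hx
    have hx' := abs_le.2 hx
    by_cases h : x ∈ cantorCore S M κ q
    · exact Or.inl h
    · right
      simp only [cantorCore, mem_ofPred_eq, not_and, not_forall, not_le] at h
      obtain ⟨n, hn⟩ := h hx'
      exact mem_iUnion.2 ⟨n, hx', hn⟩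
  have h1 := (measure_mono hsub).trans (measure_union_le (μ := volume) _ _)
  rw [Real.volume_Icc] at h1
  have h2 : ENNReal.ofReal (S / 4 - -(S / 4)) = ENNReal.ofReal (S / 4) + ENNReal.ofReal (S / 4) := by
    rw [← ENNReal.ofReal_add (by positivity) (by positivity)]; congr 1; ring
  rw [h2] at h1
  exact (ENNReal.add_le_add_iff_right ENNReal.ofReal_ne_top).1
    (h1.trans (add_le_add_right htot _))

/-! ### Heights from nested cells. -/

/-- The heights of the centers of a nested sequence of cells, whose centers have first
coordinates `Y n` and parameters `Θ n`. -/
noncomputable def cellHeight (φ : ℝ × ℝ → ℝ) (Y Θ : ℕ → ℝ) : ℕ → ℝ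
  | 0 => 0
  | n + 1 => charArc φ (Y n) (cellHeight φ Y Θ n) (Y (n + 1)) + Θ (n + 1) - Θ n

/-- The height above `y`, with parameter `τ`, computed from the `n`-th cell. -/
noncomputable def approxHeight (φ : ℝ × ℝ → ℝ) (Y Θ : ℕ → ℝ) (y τ : ℝ) (n : ℕ) : ℝ :=
  charArc φ (Y n) (cellHeight φ Y Θ n) y + τ - Θ n

theorem cellHeight_congr (φ : ℝ × ℝ → ℝ) {Y Θ Y' Θ' : ℕ → ℝ} (n : ℕ)
    (hY : ∀ k ≤ n, Y k = Y' k) (hΘ : ∀ k ≤ n, Θ k = Θ' k) :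
    cellHeight φ Y Θ n = cellHeight φ Y' Θ' n := by
  induction n with
  | zero => rfl
  | succ n ih =>
    simp only [cellHeight]
    rw [ih (fun k hk => hY k (by omega)) (fun k hk => hΘ k (by omega)), hY n (by omega),
      hY (n + 1) le_rfl, hΘ n (by omega), hΘ (n + 1) le_rfl]

/-- The oscillation hypothesis on the vertical lines, at the scales `s / 2 ^ n`. -/
def VerticalDecay (L s κ q : ℝ) (φ : ℝ × ℝ → ℝ) : Prop :=
  ∀ n : ℕ, ∀ y t t' : ℝ, |t - t'| ≤ IntrinsicBound.spread L * (s / 2 ^ n) ^ 2 →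
    |φ (y, t) - φ (y, t')| ≤ κ ^ 2 / 5 * (q ^ n) ^ 2 * (s / 2 ^ n)

/-- The cells with centers `Y n`, `Θ n` shrink to `(y, τ)`. -/
structure CellsShrinkTo (s : ℝ) (Y Θ : ℕ → ℝ) (y τ : ℝ) : Prop where
  fst : ∀ n, |y - Y n| ≤ s / 2 ^ n / 2
  snd : ∀ n, |τ - Θ n| ≤ (s / 2 ^ n) ^ 2 / 2

section

variable {L s κ q : ℝ} {φ : ℝ × ℝ → ℝ} {Y Θ : ℕ → ℝ} {y τ : ℝ}

/-- Supplies the hypotheses of `abs_charArc_sub_charArc_sub` for passing from a cell to its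
successor. The arc deviates from the line by `L r²`, and the parameter of the center moves by at
most `r²`. -/
theorem CellsShrinkTo.next (hc : CellsShrinkTo s Y Θ y τ) (hs : 0 < s) (hL : 0 ≤ L)
    (h : IntrinsicBound L φ) (n : ℕ) :
    |y - Y n| ≤ s / 2 ^ n ∧ |y - Y (n + 1)| ≤ s / 2 ^ n ∧ |Y (n + 1) - Y n| ≤ s / 2 ^ n ∧
    |cellHeight φ Y Θ (n + 1) - charLine φ (Y n) (cellHeight φ Y Θ n) (Y (n + 1))|
      ≤ (L + 2) * (s / 2 ^ n) ^ 2 := by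
  have h1 := hc.fst n
  have h2 := hc.fst (n + 1)
  have h3 := hc.snd n
  have h4 := hc.snd (n + 1)
  have e : s / 2 ^ (n + 1) = s / 2 ^ n / 2 := by rw [pow_succ]; field_simp
  rw [e] at h2 h4
  set r := s / 2 ^ n with hr
  have hr0 : 0 < r := by positivity
  have h5 : |Y (n + 1) - Y n| ≤ r := by
    have := abs_sub_le (Y (n + 1)) y (Y n)
    rw [abs_sub_comm (Y (n + 1)) y] at this; linarith
  have h6 : |Θ (n + 1) - Θ n| ≤ r ^ 2 := by
    have := abs_sub_le (Θ (n + 1)) τ (Θ n)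
    rw [abs_sub_comm (Θ (n + 1)) τ] at this; nlinarith
  refine ⟨by linarith, by linarith, h5, ?_⟩
  have h7 := h.abs_charArc_sub_charLine hL (Y n) (cellHeight φ Y Θ n) (Y (n + 1))
  have h8 : (Y (n + 1) - Y n) ^ 2 ≤ r ^ 2 := sq_le_sq' (by linarith [(abs_le.1 h5).1])
    (abs_le.1 h5).2
  have e2 : cellHeight φ Y Θ (n + 1) - charLine φ (Y n) (cellHeight φ Y Θ n) (Y (n + 1))
      = (charArc φ (Y n) (cellHeight φ Y Θ n) (Y (n + 1))
        - charLine φ (Y n) (cellHeight φ Y Θ n) (Y (n + 1))) + (Θ (n + 1) - Θ n) := by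
    simp [cellHeight]; ring
  rw [e2]
  refine (abs_add_le _ _).trans ?_
  nlinarith

/-- The old arc and the new one agree in height at the new center, after the parameter shift, so
they diverge only by the vertical oscillation times the cell length. -/
theorem CellsShrinkTo.dist_approxHeight_succ (hc : CellsShrinkTo s Y Θ y τ) (hs : 0 < s)
    (hL : 0 ≤ L) (h : IntrinsicBound L φ) (hv : VerticalDecay L s κ q φ) (n : ℕ) :
    dist (approxHeight φ Y Θ y τ n) (approxHeight φ Y Θ y τ (n + 1))
      ≤ κ ^ 2 / 5 * s ^ 2 * (q ^ 2 / 4) ^ n := by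
  obtain ⟨h1, h2, h3, h4⟩ := hc.next hs hL h n
  have hr0 : 0 < s / 2 ^ n := by positivity
  have h5 := h.abs_charArc_sub_charArc_sub hL hr0.le (hv n) h1 h3 h4
  have e : approxHeight φ Y Θ y τ (n + 1) - approxHeight φ Y Θ y τ n
      = (charArc φ (Y (n + 1)) (cellHeight φ Y Θ (n + 1)) y - cellHeight φ Y Θ (n + 1))
        - (charArc φ (Y n) (cellHeight φ Y Θ n) y
          - charArc φ (Y n) (cellHeight φ Y Θ n) (Y (n + 1))) := by
    simp only [approxHeight]
    have : cellHeight φ Y Θ (n + 1)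
      = charArc φ (Y n) (cellHeight φ Y Θ n) (Y (n + 1)) + Θ (n + 1) - Θ n := rfl
    linarith
  rw [dist_comm, Real.dist_eq, e]
  refine h5.trans ((mul_le_mul_of_nonneg_left h2 (by positivity)).trans (le_of_eq ?_))
  have : (4 : ℝ) ^ n = (2 ^ n) ^ 2 := by rw [← pow_mul, mul_comm, pow_mul]; norm_num
  rw [div_pow, this, ← pow_mul, ← pow_mul q, mul_comm 2 n]
  field_simp

theorem CellsShrinkTo.exists_height (hc : CellsShrinkTo s Y Θ y τ) (hs : 0 < s)
    (hL : 0 ≤ L) (h : IntrinsicBound L φ) (hv : VerticalDecay L s κ q φ) (hq : 0 < q)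
    (hq1 : q < 1) :
    ∃ T : ℝ, ∀ n, |T - approxHeight φ Y Θ y τ n|
      ≤ 2 * (κ ^ 2 / 5 * (q ^ n) ^ 2) * (s / 2 ^ n) ^ 2 := by
  -- A ratio below `1 / 2` bounds each tail by twice its first term.
  have hρ : q ^ 2 / 4 < 1 / 2 := by nlinarith
  have hstep := hc.dist_approxHeight_succ hs hL h hv
  obtain ⟨T, hT⟩ := cauchySeq_tendsto_of_complete
    (cauchySeq_of_le_geometric (q ^ 2 / 4) _ (by linarith) hstep)
  refine ⟨T, fun n => ?_⟩
  have h1 := dist_le_of_le_geometric_of_tendsto (q ^ 2 / 4) _ (by linarith) hstep hT n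
  rw [dist_comm, Real.dist_eq] at h1
  refine h1.trans ?_
  rw [div_le_iff₀ (by linarith)]
  have : (4 : ℝ) ^ n = (2 ^ n) ^ 2 := by rw [← pow_mul, mul_comm, pow_mul]; norm_num
  have e : κ ^ 2 / 5 * s ^ 2 * (q ^ 2 / 4) ^ n
      = κ ^ 2 / 5 * (q ^ n) ^ 2 * (s / 2 ^ n) ^ 2 := by
    rw [div_pow, this, ← pow_mul, ← pow_mul q, mul_comm 2 n]
    field_simp
  rw [e]
  have h0 : 0 ≤ κ ^ 2 / 5 * (q ^ n) ^ 2 * (s / 2 ^ n) ^ 2 := by positivity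
  nlinarith

/-- Comparison of two points lying in the same cell of level `n` and separated at the next
scale. -/
theorem CellsShrinkTo.abs_sub_le {Y' Θ' : ℕ → ℝ} {y' τ' T T' : ℝ}
    (hc : CellsShrinkTo s Y Θ y τ) (hc' : CellsShrinkTo s Y' Θ' y' τ') (hs : 0 < s)
    (hL : 0 ≤ L) (h : IntrinsicBound L φ) (hv : VerticalDecay L s κ q φ) (hq : 0 < q)
    (hq1 : q < 1) (hκ : 0 < κ) (hκ1 : κ ≤ 1) {n : ℕ}
    (hT : |T - approxHeight φ Y Θ y τ n| ≤ 2 * (κ ^ 2 / 5 * (q ^ n) ^ 2) * (s / 2 ^ n) ^ 2)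
    (hT' : |T' - approxHeight φ Y' Θ' y' τ' n|
      ≤ 2 * (κ ^ 2 / 5 * (q ^ n) ^ 2) * (s / 2 ^ n) ^ 2)
    (hY : ∀ k ≤ n, Y k = Y' k) (hΘ : ∀ k ≤ n, Θ k = Θ' k)
    (hsep : (κ * q ^ n) ^ 2 * (s / 2 ^ n) ^ 2 ≤ (y - y') ^ 2 + |τ - τ'| / 2) :
    |T - T' - φ (y', T') * (y - y') - (τ - τ')| ≤ (L + 2) * (y - y') ^ 2 + |τ - τ'| / 2 := by
  have hh := cellHeight_congr φ n hY hΘ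
  have h1 := hc.fst n
  have h1' := hc'.fst n
  have h2 := hc.snd n
  have h2' := hc'.snd n
  have hvn := hv n
  simp only [approxHeight] at hT hT'
  rw [← hh, ← hY n le_rfl, ← hΘ n le_rfl] at hT'
  rw [← hY n le_rfl] at h1'
  rw [← hΘ n le_rfl] at h2'
  rw [mul_pow] at hsep
  set r := s / 2 ^ n with hr
  have hr0 : 0 < r := by positivity
  set b := cellHeight φ Y Θ n
  set a := Y n
  set ω := κ ^ 2 / 5 * (q ^ n) ^ 2 with hω
  have hω0 : 0 ≤ ω := by positivity
  have hω1 : ω ≤ 1 / 5 := by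
    have : κ ^ 2 ≤ 1 := pow_le_one₀ hκ.le hκ1
    have : (q ^ n) ^ 2 ≤ 1 := pow_le_one₀ (by positivity) (pow_le_one₀ hq.le hq1.le)
    rw [hω]; nlinarith
  -- The five units `ω r²` of error to absorb: two for each of the tails of `T` and `T'`, and one
  -- from splitting the term `ω r |y - y'|`.
  have hsep' : 5 * ω * r ^ 2 ≤ (y - y') ^ 2 + |τ - τ'| / 2 := by
    refine le_trans (le_of_eq ?_) hsep
    rw [hω]; ring
  have hyr : |y' - a| ≤ r := by linarith
  have hline : |T' - charLine φ a b y'| ≤ (L + 2) * r ^ 2 := by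
    have h3 := h.abs_charArc_sub_charLine hL a b y'
    have h4 : (y' - a) ^ 2 ≤ r ^ 2 := sq_le_sq' (by linarith [(abs_le.1 hyr).1]) (abs_le.1 hyr).2
    have e : T' - charLine φ a b y' = (T' - (charArc φ a b y' + τ' - Θ n))
      + (charArc φ a b y' - charLine φ a b y') + (τ' - Θ n) := by ring
    rw [e]
    have h5 := abs_add_three (T' - (charArc φ a b y' + τ' - Θ n))
      (charArc φ a b y' - charLine φ a b y') (τ' - Θ n)
    have h6 : 2 * ω * r ^ 2 ≤ r ^ 2 := by nlinarith
    have h7 : L * (y' - a) ^ 2 ≤ L * r ^ 2 := mul_le_mul_of_nonneg_left h4 hL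
    linarith [sq_nonneg r]
  have hmain := h.abs_integral_charLine_sub (y := y) hL hr0.le hvn (by linarith) hyr hline
  have e : T - T' - φ (y', T') * (y - y') - (τ - τ')
      = ((charArc φ a b y - charArc φ a b y') - φ (y', T') * (y - y'))
        + (T - (charArc φ a b y + τ - Θ n)) + -(T' - (charArc φ a b y' + τ' - Θ n)) := by ring
  rw [e]
  have h5 := abs_add_three ((charArc φ a b y - charArc φ a b y') - φ (y', T') * (y - y'))
    (T - (charArc φ a b y + τ - Θ n)) (-(T' - (charArc φ a b y' + τ' - Θ n)))
  rw [abs_neg] at h5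
  have h6 : ω * r * |y - y'| ≤ (y - y') ^ 2 + ω * r ^ 2 := by
    have h7 : (ω * r) ^ 2 ≤ ω * r ^ 2 := by
      rw [mul_pow]; nlinarith [mul_nonneg hω0 (sq_nonneg r)]
    nlinarith [sq_nonneg (|y - y'| - ω * r), sq_abs (y - y')]
  linarith

end

theorem CellsShrinkTo.of_gridPoint {s : ℝ} (hs : 0 < s) (y τ : ℝ) :
    CellsShrinkTo s (fun n => gridPoint (s / 2 ^ n) y) (fun n => gridPoint (s ^ 2 / 4 ^ n) τ)
      y τ where
  fst n := abs_sub_gridPoint (by positivity) y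
  snd n := by
    have : (4 : ℝ) ^ n = (2 ^ n) ^ 2 := by rw [← pow_mul, mul_comm, pow_mul]; norm_num
    rw [div_pow, ← this]
    exact abs_sub_gridPoint (by positivity) τ

theorem eq_of_forall_abs_sub_le {y y' s M : ℝ} {Y : ℕ → ℝ} (hM : 1 < M)
    (h : ∀ n, |y - Y n| ≤ s / M ^ n) (h' : ∀ n, |y' - Y n| ≤ s / M ^ n) : y = y' := by
  have h1 : ∀ n : ℕ, |y - y'| ≤ 2 * s * (M⁻¹) ^ n := by
    intro n
    have := abs_sub_le y (Y n) y'
    rw [abs_sub_comm (Y n)] at this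
    have e : 2 * s * (M⁻¹) ^ n = s / M ^ n + s / M ^ n := by rw [inv_pow]; ring
    rw [e]; linarith [h n, h' n]
  have h2 : Tendsto (fun n : ℕ => 2 * s * (M⁻¹) ^ n) atTop (𝓝 (2 * s * 0)) :=
    (tendsto_pow_atTop_nhds_zero_of_lt_one (by positivity)
      (inv_lt_one_of_one_lt₀ hM)).const_mul _
  have h3 := ge_of_tendsto' h2 h1
  rw [mul_zero] at h3
  exact sub_eq_zero.1 (abs_nonpos_iff.1 h3)

theorem gridPoint_eq_zero_of_mem_cantorCore {S M κ q x : ℝ} (hS : 0 < S)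
    (hx : x ∈ cantorCore S M κ q) : gridPoint (S / M ^ 0) x = 0 := by
  rw [pow_zero, div_one]; exact gridPoint_eq_zero hS hx.1

/-- On a product of two Cantor sets of large measure, a function with the intrinsic bound and
with decaying vertical oscillation admits coordinates in which the characteristic curves are
nearly straight. -/
theorem exists_height_cantorCore {L s κ q : ℝ} {φ : ℝ × ℝ → ℝ} (hs : 0 < s) (hL : 0 ≤ L)
    (h : IntrinsicBound L φ) (hv : VerticalDecay L s κ q φ) (hq : 0 < q) (hq1 : q < 1)
    (hκ : 0 < κ) (hκ1 : κ ≤ 1 / 4) :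
    ∃ T : ℝ → ℝ → ℝ,
      (∀ y ∈ cantorCore s 2 κ q, ∀ τ ∈ cantorCore (s ^ 2) 4 κ q,
        |T y τ - φ (0, 0) * y - τ| ≤ (L + 1) * s ^ 2) ∧
      ∀ y ∈ cantorCore s 2 κ q, ∀ τ ∈ cantorCore (s ^ 2) 4 κ q,
      ∀ y' ∈ cantorCore s 2 κ q, ∀ τ' ∈ cantorCore (s ^ 2) 4 κ q,
        |T y τ - T y' τ' - φ (y', T y' τ') * (y - y') - (τ - τ')|
          ≤ (L + 2) * (y - y') ^ 2 + |τ - τ'| / 2 := by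
  have hex := fun y τ => (CellsShrinkTo.of_gridPoint hs y τ).exists_height hs hL h hv hq hq1
  choose T hT using hex
  have hs2 : 0 < s ^ 2 := by positivity
  refine ⟨T, fun y hy τ hτ => ?_, fun y hy τ hτ y' hy' τ' hτ' => ?_⟩
  · have h1 := hT y τ 0
    simp only [approxHeight, cellHeight, gridPoint_eq_zero_of_mem_cantorCore hs hy,
      gridPoint_eq_zero_of_mem_cantorCore hs2 hτ] at h1
    have h2 := h.abs_charArc_sub_charLine hL 0 0 y
    simp only [charLine, sub_zero, zero_add, pow_zero, one_pow, mul_one, div_one] at h1 h2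
    have h3 : y ^ 2 ≤ s ^ 2 := by
      have := abs_le.1 hy.1
      exact sq_le_sq' (by linarith) (by linarith)
    have e : T y τ - φ (0, 0) * y - τ
        = (T y τ - (charArc φ 0 0 y + τ)) + (charArc φ 0 0 y - φ (0, 0) * y) := by ring
    rw [e]
    refine (abs_add_le _ _).trans ?_
    have h4 : 2 * (κ ^ 2 / 5) * s ^ 2 ≤ s ^ 2 := by
      have : κ ^ 2 ≤ 1 := pow_le_one₀ hκ.le (by linarith)
      nlinarith
    have h5 := mul_le_mul_of_nonneg_left h3 hL
    linarith
  -- Compare the points in the last cell they share; if there is no last one, they coincide.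
  · by_cases hsame : ∀ n, gridPoint (s / 2 ^ n) y = gridPoint (s / 2 ^ n) y' ∧
      gridPoint (s ^ 2 / 4 ^ n) τ = gridPoint (s ^ 2 / 4 ^ n) τ'
    · have hy0 : y = y' := by
        refine eq_of_forall_abs_sub_le (s := s) (M := 2) (by norm_num)
          (Y := fun n => gridPoint (s / 2 ^ n) y) (fun n => ?_) (fun n => ?_)
        · have := abs_sub_gridPoint (s := s / 2 ^ n) (by positivity) y
          have : 0 < s / 2 ^ n := by positivity
          linarith
        · have := abs_sub_gridPoint (s := s / 2 ^ n) (by positivity) y'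
          have : 0 < s / 2 ^ n := by positivity
          rw [(hsame n).1]; linarith
      have hτ0 : τ = τ' := by
        refine eq_of_forall_abs_sub_le (s := s ^ 2) (M := 4) (by norm_num)
          (Y := fun n => gridPoint (s ^ 2 / 4 ^ n) τ) (fun n => ?_) (fun n => ?_)
        · have := abs_sub_gridPoint (s := s ^ 2 / 4 ^ n) (by positivity) τ
          have : 0 < s ^ 2 / 4 ^ n := by positivity
          linarith
        · have := abs_sub_gridPoint (s := s ^ 2 / 4 ^ n) (by positivity) τ'
          have : 0 < s ^ 2 / 4 ^ n := by positivity
          rw [(hsame n).2]; linarith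
      subst hy0 hτ0
      simp
    · classical
      push Not at hsame
      obtain ⟨m, hm, hmin⟩ : ∃ m, ¬ (gridPoint (s / 2 ^ m) y = gridPoint (s / 2 ^ m) y' ∧
          gridPoint (s ^ 2 / 4 ^ m) τ = gridPoint (s ^ 2 / 4 ^ m) τ') ∧
          ∀ k < m, gridPoint (s / 2 ^ k) y = gridPoint (s / 2 ^ k) y' ∧
          gridPoint (s ^ 2 / 4 ^ k) τ = gridPoint (s ^ 2 / 4 ^ k) τ' := by
        have hex : ∃ m, ¬ (gridPoint (s / 2 ^ m) y = gridPoint (s / 2 ^ m) y' ∧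
          gridPoint (s ^ 2 / 4 ^ m) τ = gridPoint (s ^ 2 / 4 ^ m) τ') := by
          obtain ⟨n, hn⟩ := hsame
          exact ⟨n, fun hh => hn hh.1 hh.2⟩
        exact ⟨Nat.find hex, Nat.find_spec hex, fun k hk => not_not.1 (Nat.find_min hex hk)⟩
      -- Separation cannot occur at level `0`: the cores stay within a quarter of the top cell's
      -- side from its center, so they lie in that one cell.
      obtain _ | n := m
      · exact absurd ⟨by rw [gridPoint_eq_zero_of_mem_cantorCore hs hy,
          gridPoint_eq_zero_of_mem_cantorCore hs hy'],
          by rw [gridPoint_eq_zero_of_mem_cantorCore hs2 hτ,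
          gridPoint_eq_zero_of_mem_cantorCore hs2 hτ']⟩ hm
      refine (CellsShrinkTo.of_gridPoint hs y τ).abs_sub_le (CellsShrinkTo.of_gridPoint hs y' τ')
        hs hL h hv hq hq1 hκ (by linarith) (hT y τ n) (hT y' τ' n)
        (fun k hk => (hmin k (by omega)).1) (fun k hk => (hmin k (by omega)).2) ?_
      have hε0 : 0 < κ * q ^ n := by positivity
      have hε1 : κ * q ^ n ≤ 1 / 4 := by
        have : q ^ n ≤ 1 := pow_le_one₀ hq.le hq1.le
        nlinarith
      set r := s / 2 ^ n with hr
      have hr0 : 0 < r := by positivity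
      by_cases hYne : gridPoint (s / 2 ^ (n + 1)) y = gridPoint (s / 2 ^ (n + 1)) y'
      · have h1 := le_abs_sub_of_gridPoint_ne (by positivity) (hτ.2 n) (hτ'.2 n)
          (fun hh => hm ⟨hYne, hh⟩)
        have e : s ^ 2 / 4 ^ (n + 1) = r ^ 2 / 4 := by
          have : (4 : ℝ) ^ n = (2 ^ n) ^ 2 := by rw [← pow_mul, mul_comm, pow_mul]; norm_num
          rw [pow_succ (4 : ℝ), this, hr]; field_simp
        rw [e] at h1
        -- The `τ` gap is linear in the margin while the required bound is quadratic, so `κ q ^ n ≤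
        -- 1 / 4` suffices. The `y` gap below enters squared and matches exactly.
        have h2 : (κ * q ^ n) ^ 2 * r ^ 2 ≤ 1 / 4 * (κ * q ^ n) * r ^ 2 :=
          mul_le_mul_of_nonneg_right (by nlinarith) (by positivity)
        nlinarith [sq_nonneg (y - y')]
      · have h1 := le_abs_sub_of_gridPoint_ne (by positivity) (hy.2 n) (hy'.2 n) hYne
        have e : s / 2 ^ (n + 1) = r / 2 := by rw [pow_succ, hr]; field_simp
        rw [e] at h1
        have h2 : κ * q ^ n * r ≤ |y - y'| := by linarith
        have h3 : (κ * q ^ n * r) ^ 2 ≤ (y - y') ^ 2 := by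
          rw [← sq_abs (y - y')]
          exact pow_le_pow_left₀ (by positivity) h2 2
        rw [← mul_pow]
        linarith [abs_nonneg (τ - τ')]

/-! ### Korányi norm estimates and the topology of the Heisenberg group. -/

namespace Heis

theorem abs_x_le_koranyi (p : Heis) : |p.x| ≤ p.koranyi := by
  refine le_of_pow_le_pow_left₀ (n := 4) (by norm_num) p.koranyi_nonneg ?_
  rw [koranyi_pow_four, show |p.x| ^ 4 = (p.x ^ 2) ^ 2 by rw [← sq_abs p.x]; ring]
  nlinarith [sq_nonneg p.x, sq_nonneg p.y, sq_nonneg p.t, mul_nonneg (sq_nonneg p.x) (sq_nonneg p.y)]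

theorem abs_y_le_koranyi (p : Heis) : |p.y| ≤ p.koranyi := by
  refine le_of_pow_le_pow_left₀ (n := 4) (by norm_num) p.koranyi_nonneg ?_
  rw [koranyi_pow_four, show |p.y| ^ 4 = (p.y ^ 2) ^ 2 by rw [← sq_abs p.y]; ring]
  nlinarith [sq_nonneg p.x, sq_nonneg p.y, sq_nonneg p.t, mul_nonneg (sq_nonneg p.x) (sq_nonneg p.y)]

theorem four_mul_abs_t_le_koranyi_sq (p : Heis) : 4 * |p.t| ≤ p.koranyi ^ 2 := by
  refine le_of_pow_le_pow_left₀ (n := 2) (by norm_num) (by positivity) ?_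
  rw [← pow_mul, koranyi_pow_four, mul_pow, sq_abs]
  nlinarith [sq_nonneg (p.x ^ 2 + p.y ^ 2)]

theorem koranyi_le_add (a X : ℝ) : koranyi ⟨0, a, X⟩ ≤ |a| + 2 * √|X| := by
  refine le_of_pow_le_pow_left₀ (n := 4) (by norm_num) (by positivity) ?_
  rw [koranyi_pow_four]
  have h1 : √|X| ^ 2 = |X| := Real.sq_sqrt (abs_nonneg X)
  have h2 : √|X| ^ 4 = X ^ 2 := by rw [show √|X| ^ 4 = (√|X| ^ 2) ^ 2 by ring, h1, sq_abs]
  have h3 : |a| ^ 4 = a ^ 4 := by rw [show |a| ^ 4 = (|a| ^ 2) ^ 2 by ring, sq_abs]; ring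
  have hu := abs_nonneg a
  have hv := Real.sqrt_nonneg |X|
  have e : (|a| + 2 * √|X|) ^ 4 = |a| ^ 4 + 16 * √|X| ^ 4
    + (8 * (|a| ^ 3 * √|X|) + 24 * (|a| ^ 2 * √|X| ^ 2) + 32 * (|a| * √|X| ^ 3)) := by ring
  rw [e, h2, h3]
  have : 0 ≤ 8 * (|a| ^ 3 * √|X|) + 24 * (|a| ^ 2 * √|X| ^ 2) + 32 * (|a| * √|X| ^ 3) := by
    positivity
  simp only
  linarith

theorem koranyi_projV (p : Heis) : p.projV.koranyi = |p.x| := by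
  refine (pow_left_inj₀ (koranyi_nonneg _) (abs_nonneg _) (n := 4) (by norm_num)).1 ?_
  rw [koranyi_pow_four, show |p.x| ^ 4 = (p.x ^ 2) ^ 2 by rw [← sq_abs p.x]; ring]
  simp [projV]

theorem koranyi_projW_le (p : Heis) : p.projW.koranyi ≤ 2 * p.koranyi := by
  have h1 : p.projW = p * p.projV⁻¹ := eq_mul_inv_of_mul_eq p.projW_mul_projV
  have h2 := koranyi_mul_le p p.projV⁻¹
  rw [koranyi_inv, koranyi_projV] at h2
  rw [h1]; linarith [p.abs_x_le_koranyi]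

theorem koranyi_le_projW_add (p : Heis) : p.koranyi ≤ p.projW.koranyi + |p.x| := by
  have h2 := koranyi_mul_le p.projW p.projV
  rwa [koranyi_projV, projW_mul_projV] at h2

section continuity

theorem continuous_coords : Continuous (fun w : ℝ × ℝ × ℝ => (⟨w.1, w.2.1, w.2.2⟩ : Heis)) := by
  rw [continuous_iff_continuousAt]
  rintro ⟨x, a, b⟩
  rw [ContinuousAt, tendsto_iff_dist_tendsto_zero]
  have hc : Continuous (fun w : ℝ × ℝ × ℝ =>
      dist (⟨w.1, w.2.1, w.2.2⟩ : Heis) ⟨x, a, b⟩) := by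
    simp only [dist_eq, koranyi]
    refine Continuous.rpow_const ?_ (fun _ => Or.inr (by norm_num))
    simp only [mul_x, mul_y, mul_t, inv_x, inv_y, inv_t]
    fun_prop
  have := hc.tendsto (x, a, b)
  simpa using this

theorem continuous_mk (x : ℝ) : Continuous (fun w : ℝ × ℝ => (⟨x, w.1, w.2⟩ : Heis)) :=
  continuous_coords.comp (Continuous.prodMk_right x)

instance : SecondCountableTopology Heis := by
  have hs : Function.Surjective (fun w : ℝ × ℝ × ℝ => (⟨w.1, w.2.1, w.2.2⟩ : Heis)) :=
    fun p => ⟨(p.x, p.y, p.t), rfl⟩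
  have := hs.denseRange.separableSpace continuous_coords
  exact UniformSpace.secondCountable_of_separable Heis

theorem abs_sub_x_le_dist (p q : Heis) : |p.x - q.x| ≤ dist p q := by
  have := abs_x_le_koranyi (q⁻¹ * p)
  rw [dist_eq]
  simpa [neg_add_eq_sub] using this

theorem abs_sub_y_le_dist (p q : Heis) : |p.y - q.y| ≤ dist p q := by
  have := abs_y_le_koranyi (q⁻¹ * p)
  rw [dist_eq]
  simpa [neg_add_eq_sub] using this

theorem continuous_x : Continuous Heis.x :=
  (LipschitzWith.of_dist_le' (K := 1) fun p q => by
    rw [Real.dist_eq, one_mul]; exact abs_sub_x_le_dist p q).continuous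

theorem continuous_y : Continuous Heis.y :=
  (LipschitzWith.of_dist_le' (K := 1) fun p q => by
    rw [Real.dist_eq, one_mul]; exact abs_sub_y_le_dist p q).continuous

/-- Not Lipschitz: the vertical increment is of order `dist²` plus a twist term, which is continuous
and vanishes at the base point. -/
theorem continuous_t : Continuous Heis.t := by
  rw [continuous_iff_continuousAt]
  intro q
  rw [ContinuousAt, tendsto_iff_dist_tendsto_zero]
  have hlim : Tendsto (fun p : Heis => dist p q ^ 2 + |-q.x * p.y + q.y * p.x| / 2) (𝓝 q)
      (𝓝 0) := by
    have hx := continuous_x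
    have hy := continuous_y
    have hc : Continuous (fun p : Heis => dist p q ^ 2 + |-q.x * p.y + q.y * p.x| / 2) := by
      fun_prop
    have := hc.tendsto q
    have e : -q.x * q.y + q.y * q.x = 0 := by ring
    simpa [e, mul_comm] using this
  refine squeeze_zero (fun _ => dist_nonneg) (fun p => ?_) hlim
  have h1 := four_mul_abs_t_le_koranyi_sq (q⁻¹ * p)
  rw [← dist_eq] at h1
  simp only [mul_t, inv_t, inv_x, inv_y] at h1
  have e : p.t - q.t = (-q.t + p.t + (-q.x * p.y - -q.y * p.x) / 2)
    - (-q.x * p.y + q.y * p.x) / 2 := by ring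
  rw [Real.dist_eq, e]
  refine (abs_sub _ _).trans ?_
  rw [abs_div, abs_two]
  have := abs_nonneg (-q.t + p.t + (-q.x * p.y - -q.y * p.x) / 2)
  linarith

end continuity

/-! ### Distances on an intrinsic graph -/

section graph

variable (φ : ℝ × ℝ → ℝ)

theorem graphMap_eq (w : ℝ × ℝ) : graphMap φ w = ⟨φ w, w.1, w.2 - w.1 * φ w / 2⟩ := by
  ext <;> simp [graphMap]; ring

theorem inv_graphMap_mul_x (w w' : ℝ × ℝ) :
    ((graphMap φ w')⁻¹ * graphMap φ w).x = φ w - φ w' := by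
  simp [graphMap_eq]; ring

theorem projW_inv_graphMap_mul (w w' : ℝ × ℝ) :
    projW ((graphMap φ w')⁻¹ * graphMap φ w)
      = ⟨0, w.1 - w'.1, w.2 - w'.2 - φ w' * (w.1 - w'.1)⟩ := by
  simp [projW, graphMap_eq]
  constructor <;> ring

/-- The size of the increment from `w'` to `w`, measured along the slope at `w'`. -/
noncomputable def slopeDist (w w' : ℝ × ℝ) : ℝ :=
  koranyi ⟨0, w.1 - w'.1, w.2 - w'.2 - φ w' * (w.1 - w'.1)⟩

theorem slopeDist_le_two_mul_dist (w w' : ℝ × ℝ) :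
    slopeDist φ w w' ≤ 2 * dist (graphMap φ w) (graphMap φ w') := by
  rw [slopeDist, ← projW_inv_graphMap_mul, dist_eq]
  exact koranyi_projW_le _

theorem slopeDist_nonneg (w w' : ℝ × ℝ) : 0 ≤ slopeDist φ w w' := koranyi_nonneg _

variable {φ}

/-- A violation leaves room for an aperture `a < L⁻¹` whose cone at `Φ w'` contains `Φ w`; then the
two points coincide, contradicting `φ w ≠ φ w'`. -/
theorem IsIntrinsicLipschitzWith.abs_sub_le {L : ℝ} (hL : 0 < L)
    (h : IsIntrinsicLipschitzWith L φ) (w w' : ℝ × ℝ) :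
    |φ w - φ w'| ≤ L * slopeDist φ w w' := by
  by_contra! hlt
  have hk := slopeDist_nonneg φ w w'
  have h0 : 0 < |φ w - φ w'| := lt_of_le_of_lt (by positivity) hlt
  have h1 : slopeDist φ w w' / |φ w - φ w'| < L⁻¹ := by
    rw [div_lt_iff₀ h0, ← div_eq_inv_mul, lt_div_iff₀ hL]; linarith
  obtain ⟨a, ha1, ha2⟩ := exists_between h1
  have ha0 : 0 < a := lt_of_le_of_lt (by positivity) ha1
  have hmem : graphMap φ w ∈ intrinsicGraph φ ∩ (fun q => graphMap φ w' * q) '' cone a := by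
    refine ⟨mem_range_self w, (graphMap φ w')⁻¹ * graphMap φ w, ?_, by simp⟩
    change koranyi _ ≤ a * koranyi _
    rw [koranyi_projV, inv_graphMap_mul_x, projW_inv_graphMap_mul]
    exact (div_le_iff₀ h0).1 ha1.le
  rw [h _ (mem_range_self w') a ha0 ha2] at hmem
  have hx := congrArg Heis.x hmem
  simp only [graphMap_eq] at hx
  rw [hx] at h0
  simp at h0

theorem dist_graphMap_le {L : ℝ} (h : ∀ w w', |φ w - φ w'| ≤ L * slopeDist φ w w')
    (w w' : ℝ × ℝ) : dist (graphMap φ w) (graphMap φ w') ≤ (1 + L) * slopeDist φ w w' := by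
  have h1 := koranyi_le_projW_add ((graphMap φ w')⁻¹ * graphMap φ w)
  rw [inv_graphMap_mul_x, projW_inv_graphMap_mul, ← dist_eq] at h1
  have h2 := h w w'
  unfold slopeDist at h2 ⊢
  linarith

theorem intrinsicBound_of_slopeDist {L : ℝ} (hL : 0 ≤ L)
    (h : ∀ w w', |φ w - φ w'| ≤ L * slopeDist φ w w') : IntrinsicBound (2 * L) φ := by
  intro y t y' t'
  have h1 := koranyi_le_add (y - y') (t - t' - φ (y', t') * (y - y'))
  refine (h (y, t) (y', t')).trans ?_
  have h2 : slopeDist φ (y, t) (y', t')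
    ≤ 2 * (|y - y'| + √|t - t' - φ (y', t') * (y - y')|) := by
    unfold slopeDist
    refine h1.trans ?_
    linarith [abs_nonneg (y - y')]
  nlinarith

theorem mem_intrinsicGraph_iff (p : Heis) :
    p ∈ intrinsicGraph φ ↔ p.x = φ (p.y, p.t + p.x * p.y / 2) := by
  constructor
  · rintro ⟨w, rfl⟩
    simp only [graphMap_eq]
    congr 1
    ext <;> simp; ring
  · intro h
    refine ⟨(p.y, p.t + p.x * p.y / 2), ?_⟩
    rw [graphMap_eq, ← h]
    ext <;> simp; ring

theorem isClosed_intrinsicGraph (h : Continuous φ) : IsClosed (intrinsicGraph φ) := by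
  have : intrinsicGraph φ = {p | p.x = φ (p.y, p.t + p.x * p.y / 2)} := by
    ext p; exact mem_intrinsicGraph_iff p
  rw [this]
  have hx := continuous_x
  have hy := continuous_y
  have ht := continuous_t
  exact isClosed_eq hx (h.comp (by fun_prop))

end graph

/-- The coefficient `1 / 2` is below `1`, so `|τ|` can be absorbed and each of `|X|`, `|τ|` is
bounded by the other plus a multiple of `a²`. -/
theorem koranyi_comparison {M a X τ : ℝ} (hM : 1 ≤ M) (h : |X - τ| ≤ M * a ^ 2 + |τ| / 2) :
    koranyi ⟨0, a, X⟩ ≤ 9 * M * koranyi ⟨0, a, τ⟩ ∧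
    koranyi ⟨0, a, τ⟩ ≤ 9 * M * koranyi ⟨0, a, X⟩ := by
  have hX : |X| ≤ M * a ^ 2 + 3 / 2 * |τ| := by
    have := abs_add_le (X - τ) τ
    rw [sub_add_cancel] at this; linarith
  have hτ : |τ| ≤ 2 * M * a ^ 2 + 2 * |X| := by
    have := abs_sub_abs_le_abs_sub τ X
    rw [abs_sub_comm] at this; linarith
  have hX2 : X ^ 2 ≤ 2 * M ^ 2 * a ^ 4 + 9 / 2 * τ ^ 2 := by
    rw [← sq_abs X, ← sq_abs τ]
    have := pow_le_pow_left₀ (abs_nonneg X) hX 2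
    nlinarith [sq_nonneg (M * a ^ 2 - 3 / 2 * |τ|)]
  have hτ2 : τ ^ 2 ≤ 8 * M ^ 2 * a ^ 4 + 8 * X ^ 2 := by
    rw [← sq_abs X, ← sq_abs τ]
    have := pow_le_pow_left₀ (abs_nonneg τ) hτ 2
    nlinarith [sq_nonneg (2 * M * a ^ 2 - 2 * |X|)]
  have hM2 : 1 ≤ M ^ 2 := one_le_pow₀ hM
  have hM4 : M ^ 2 ≤ M ^ 4 := pow_le_pow_right₀ hM (by norm_num)
  have ha : 0 ≤ a ^ 4 := by positivity
  have key : ∀ u v : ℝ, u ^ 2 ≤ 8 * M ^ 2 * a ^ 4 + 8 * v ^ 2 →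
      koranyi ⟨0, a, u⟩ ≤ 9 * M * koranyi ⟨0, a, v⟩ := by
    intro u v huv
    refine le_of_pow_le_pow_left₀ (n := 4) (by norm_num)
      (mul_nonneg (by linarith) (koranyi_nonneg _)) ?_
    rw [mul_pow, koranyi_pow_four, koranyi_pow_four]
    simp only
    have e1 : ((0 : ℝ) ^ 2 + a ^ 2) ^ 2 = a ^ 4 := by ring
    rw [e1, mul_pow]
    have hav : 0 ≤ a ^ 4 + 16 * v ^ 2 := by positivity
    have h1 : a ^ 4 + 16 * u ^ 2 ≤ 200 * M ^ 2 * (a ^ 4 + 16 * v ^ 2) := by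
      nlinarith [mul_le_mul_of_nonneg_right hM2 ha, mul_le_mul_of_nonneg_right hM2 (sq_nonneg v)]
    have h2 : 200 * M ^ 2 * (a ^ 4 + 16 * v ^ 2) ≤ 9 ^ 4 * M ^ 4 * (a ^ 4 + 16 * v ^ 2) :=
      mul_le_mul_of_nonneg_right (by nlinarith) hav
    exact h1.trans h2
  refine ⟨key X τ ?_, key τ X hτ2⟩
  nlinarith [mul_nonneg (sq_nonneg M) ha, sq_nonneg τ]

end Heis

/-! ### The parabolic plane, and measure of bilipschitz images. -/

namespace ParabolicPlane

theorem dist_eq_koranyi (v w : ParabolicPlane) :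
    dist v w = Heis.koranyi ⟨0, v.y - w.y, v.t - w.t⟩ := by
  have h : dist v w = (v - w).parabolicNorm := rfl
  rw [h, parabolicNorm_sub, Heis.dist_eq]
  congr 1
  ext <;> simp [toHeis] <;> ring

theorem isometry_toHeis : Isometry toHeis :=
  Isometry.of_dist_eq fun v w => (parabolicNorm_sub v w).symm

theorem continuous_mk : Continuous (fun w : ℝ × ℝ => (⟨w.1, w.2⟩ : ParabolicPlane)) :=
  isometry_toHeis.isEmbedding.continuous_iff.2 (Heis.continuous_mk 0)

/-- The product of two sets of reals, as a subset of the parabolic plane. -/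
def box (A B : Set ℝ) : Set ParabolicPlane := {v | v.y ∈ A ∧ v.t ∈ B}

theorem isCompact_box {A B : Set ℝ} (hA : IsCompact A) (hB : IsCompact B) :
    IsCompact (box A B) := by
  have : box A B = (fun w : ℝ × ℝ => (⟨w.1, w.2⟩ : ParabolicPlane)) '' (A ×ˢ B) := by
    ext v
    constructor
    · rintro ⟨h1, h2⟩; exact ⟨(v.y, v.t), ⟨h1, h2⟩, rfl⟩
    · rintro ⟨w, ⟨h1, h2⟩, rfl⟩; exact ⟨h1, h2⟩
  rw [this]
  exact (hA.prod hB).image continuous_mk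

end ParabolicPlane

namespace Heis

/-- Lebesgue measure on the vertical subgroup `{x = 0}`. -/
noncomputable def verticalVolume : Measure Heis :=
  (volume : Measure (ℝ × ℝ)).map (fun w => (⟨0, w.1, w.2⟩ : Heis))

/-- Mass distribution: a set of diameter `d` meeting the plane has its trace in a rectangle of sides
`2 d` and `d² / 2`, whose area is exactly `d³`. -/
theorem verticalVolume_le : verticalVolume ≤ μH[3] := by
  have hmeas : Measurable (fun w : ℝ × ℝ => (⟨0, w.1, w.2⟩ : Heis)) :=
    (continuous_mk 0).measurable
  refine Measure.le_hausdorffMeasure 3 _ 1 one_pos fun s hs => ?_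
  by_cases hne : ∃ w : ℝ × ℝ, (⟨0, w.1, w.2⟩ : Heis) ∈ s
  · obtain ⟨⟨a, b⟩, hw⟩ := hne
    have hfin : Metric.ediam s ≠ ∞ := ne_top_of_le_ne_top ENNReal.one_ne_top hs
    set d := (Metric.ediam s).toReal with hd
    have hd0 : 0 ≤ d := ENNReal.toReal_nonneg
    have hsub : s ⊆ Metric.closedBall (⟨0, a, b⟩ : Heis) d := fun p hp => by
      rw [Metric.mem_closedBall]
      rw [hd, dist_edist]
      exact ENNReal.toReal_mono hfin (Metric.edist_le_ediam_of_mem hp hw)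
    refine (measure_mono hsub).trans ?_
    rw [verticalVolume, Measure.map_apply hmeas Metric.isClosed_closedBall.measurableSet]
    have hbox : (fun w : ℝ × ℝ => (⟨0, w.1, w.2⟩ : Heis)) ⁻¹' Metric.closedBall ⟨0, a, b⟩ d ⊆
        Icc (a - d) (a + d) ×ˢ Icc (b - d ^ 2 / 4) (b + d ^ 2 / 4) := by
      rintro ⟨y, t⟩ hyt
      rw [mem_preimage, Metric.mem_closedBall, dist_eq] at hyt
      have h1 := abs_y_le_koranyi ((⟨0, a, b⟩ : Heis)⁻¹ * ⟨0, y, t⟩)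
      have h2 := four_mul_abs_t_le_koranyi_sq ((⟨0, a, b⟩ : Heis)⁻¹ * ⟨0, y, t⟩)
      have h3 := pow_le_pow_left₀ (koranyi_nonneg _) hyt 2
      simp only [mul_y, mul_t, inv_x, inv_y, inv_t] at h1 h2
      have h4 := abs_le.1 (h1.trans hyt)
      have h5 : |-b + t + (-0 * y - -a * 0) / 2| ≤ d ^ 2 / 4 := by linarith
      have h6 := abs_le.1 h5
      refine ⟨⟨?_, ?_⟩, ⟨?_, ?_⟩⟩ <;> simp only <;> linarith
    refine (measure_mono hbox).trans ?_
    rw [Measure.volume_eq_prod, Measure.prod_prod, Real.volume_Icc, Real.volume_Icc,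
      ← ENNReal.ofReal_mul (by linarith), ← ENNReal.ofReal_toReal hfin, ← hd,
      ENNReal.ofReal_rpow_of_nonneg hd0 (by norm_num)]
    apply ENNReal.ofReal_le_ofReal
    rw [show (3 : ℝ) = ((3 : ℕ) : ℝ) by norm_num, Real.rpow_natCast]
    apply le_of_eq; ring
  · have h0 : verticalVolume {p : Heis | p.x = 0}ᶜ = 0 := by
      rw [verticalVolume, Measure.map_apply hmeas
        (isClosed_eq continuous_x continuous_const).measurableSet.compl]
      simp
    have hsub : s ⊆ {p : Heis | p.x = 0}ᶜ := by
      intro p hp hx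
      refine hne ⟨(p.y, p.t), ?_⟩
      have : p = ⟨0, p.y, p.t⟩ := by ext <;> simp; exact hx
      rwa [← this]
    rw [measure_mono_null hsub h0]
    exact zero_le

/-- The inverse of `f` on its image is `Λ`-Lipschitz, so it increases `μH[3]` by at most `Λ ^ 3`,
and `μH[3]` dominates Lebesgue measure on the plane. -/
theorem volume_mul_le_of_isBilipschitzOn {Λ : ℝ} (hΛ : 1 ≤ Λ) {f : ParabolicPlane → Heis}
    {A B : Set ℝ} (hA : IsClosed A) (hB : IsClosed B)
    (hf : IsBilipschitzOn Λ f (ParabolicPlane.box A B)) :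
    volume A * volume B
      ≤ ENNReal.ofReal (Λ ^ 3) * μH[3] (f '' ParabolicPlane.box A B) := by
  set K := ParabolicPlane.box A B with hK
  have h1 : volume A * volume B ≤ verticalVolume (ParabolicPlane.toHeis '' K) := by
    have hcl : IsClosed {p : Heis | p.x = 0 ∧ p.y ∈ A ∧ p.t ∈ B} :=
      (isClosed_eq continuous_x continuous_const).inter
        ((hA.preimage continuous_y).inter (hB.preimage continuous_t))
    have e : ParabolicPlane.toHeis '' K = {p : Heis | p.x = 0 ∧ p.y ∈ A ∧ p.t ∈ B} := by
      ext p
      constructor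
      · rintro ⟨v, hv, rfl⟩; exact ⟨rfl, hv.1, hv.2⟩
      · rintro ⟨hx, hy, ht⟩
        exact ⟨⟨p.y, p.t⟩, ⟨hy, ht⟩, by ext <;> simp [ParabolicPlane.toHeis, hx]⟩
    rw [e, verticalVolume, Measure.map_apply (continuous_mk 0).measurable hcl.measurableSet,
      ← Measure.prod_prod, ← Measure.volume_eq_prod]
    apply measure_mono
    rintro w ⟨hw1, hw2⟩
    exact ⟨rfl, hw1, hw2⟩
  refine h1.trans ((verticalVolume_le _).trans ?_)
  obtain ⟨g, hg⟩ : ∃ g : Heis → ParabolicPlane, ∀ v ∈ K, g (f v) = v := by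
    have hinj : InjOn f K := by
      intro v hv w hw hvw
      have := (hf v hv w hw).1
      rw [hvw, dist_self] at this
      have h0 : 0 < Λ⁻¹ := by positivity
      have h2 : dist v w ≤ 0 := by
        by_contra! h3
        nlinarith [mul_pos h0 h3]
      exact dist_le_zero.1 h2
    have : Nonempty ParabolicPlane := ⟨0⟩
    exact ⟨Function.invFunOn f K, fun v hv => hinj.leftInvOn_invFunOn hv⟩
  have hlip : LipschitzOnWith (Real.toNNReal Λ) (fun p => (g p).toHeis) (f '' K) := by
    refine LipschitzOnWith.of_dist_le_mul ?_
    rintro _ ⟨v, hv, rfl⟩ _ ⟨w, hw, rfl⟩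
    rw [hg v hv, hg w hw, ParabolicPlane.isometry_toHeis.dist_eq,
      Real.coe_toNNReal _ (by linarith)]
    have := (hf v hv w hw).1
    rwa [inv_mul_le_iff₀ (by linarith)] at this
  have h2 := hlip.hausdorffMeasure_image_le (d := 3) (by norm_num)
  have e : (fun p => (g p).toHeis) '' (f '' K) = ParabolicPlane.toHeis '' K := by
    rw [image_image]
    exact image_congr fun v hv => by rw [hg v hv]
  rw [e] at h2
  refine h2.trans (le_of_eq ?_)
  congr 1
  rw [show ((Real.toNNReal Λ : ℝ≥0) : ℝ≥0∞) = ENNReal.ofReal Λ from rfl,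
    ENNReal.ofReal_rpow_of_nonneg (by linarith) (by norm_num),
    show (3 : ℝ) = ((3 : ℕ) : ℝ) by norm_num, Real.rpow_natCast]

/-- `E` contains, in the ball of radius `r` about `p`, a `Λ`-bilipschitz image of a compact
subset of the parabolic plane, of measure at least `θ r ^ 3`. -/
def HasBigPiece (E : Set Heis) (Λ θ : ℝ) (p : Heis) (r : ℝ) : Prop :=
  ∃ (K : Set ParabolicPlane) (f : ParabolicPlane → Heis),
    IsCompact K ∧ K ⊆ Metric.ball 0 r ∧ IsBilipschitzOn Λ f K ∧
      ENNReal.ofReal (θ * r ^ 3) ≤ μH[3] (f '' K ∩ (E ∩ Metric.ball p r))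

theorem HasBigPiece.mono {E : Set Heis} {Λ Λ' θ θ' r R : ℝ} {p : Heis}
    (h : HasBigPiece E Λ θ p r) (hΛ0 : 0 < Λ) (hΛ : Λ ≤ Λ') (hr : r ≤ R)
    (hθ : θ' * R ^ 3 ≤ θ * r ^ 3) : HasBigPiece E Λ' θ' p R := by
  obtain ⟨K, f, hK, hKr, hf, hm⟩ := h
  refine ⟨K, f, hK, hKr.trans (Metric.ball_subset_ball hr), fun v hv w hw => ?_, ?_⟩
  · obtain ⟨h1, h2⟩ := hf v hv w hw
    exact ⟨(mul_le_mul_of_nonneg_right (inv_anti₀ hΛ0 hΛ) dist_nonneg).trans h1,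
      h2.trans (mul_le_mul_of_nonneg_right hΛ dist_nonneg)⟩
  · refine (ENNReal.ofReal_le_ofReal hθ).trans (hm.trans (measure_mono ?_))
    exact inter_subset_inter_right _ (inter_subset_inter_right _ (Metric.ball_subset_ball hr))

theorem HasBigPiece.of_box {E : Set Heis} {Λ c r : ℝ} {p : Heis} (hΛ : 1 ≤ Λ) (hr : 0 < r)
    (hc : 0 < c) (hcr : 2 * c ≤ 1) {A B : Set ℝ} (hA : IsClosed A) (hB : IsClosed B)
    (hAr : ∀ y ∈ A, |y| ≤ c * r) (hBr : ∀ t ∈ B, |t| ≤ (c * r) ^ 2 / 16)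
    {θ : ℝ} (hAB : ENNReal.ofReal (Λ ^ 3 * θ * r ^ 3) ≤ volume A * volume B)
    {f : ParabolicPlane → Heis} (hf : IsBilipschitzOn Λ f (ParabolicPlane.box A B))
    (hfE : ∀ v ∈ ParabolicPlane.box A B, f v ∈ E ∩ Metric.ball p r) :
    HasBigPiece E Λ θ p r := by
  have hcompA : IsCompact A := Metric.isCompact_of_isClosed_isBounded hA
    ((Metric.isBounded_Icc (-(c * r)) (c * r)).subset fun y hy => abs_le.1 (hAr y hy))
  have hcompB : IsCompact B := Metric.isCompact_of_isClosed_isBounded hB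
    ((Metric.isBounded_Icc (-((c * r) ^ 2 / 16)) ((c * r) ^ 2 / 16)).subset
      fun y hy => abs_le.1 (hBr y hy))
  refine ⟨ParabolicPlane.box A B, f, ParabolicPlane.isCompact_box hcompA hcompB, ?_, hf, ?_⟩
  · intro v hv
    have hz : (0 : ParabolicPlane) = ⟨0, 0⟩ := rfl
    rw [Metric.mem_ball, ParabolicPlane.dist_eq_koranyi, hz]
    have h1 := koranyi_le_add v.y v.t
    have h2 : √|v.t| ≤ c * r / 4 := by
      rw [show c * r / 4 = √((c * r) ^ 2 / 16) by
        rw [show (c * r) ^ 2 / 16 = (c * r / 4) ^ 2 by ring, Real.sqrt_sq (by positivity)]]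
      exact Real.sqrt_le_sqrt (hBr _ hv.2)
    have h3 := hAr _ hv.1
    simp only [sub_zero]
    nlinarith [mul_pos hc hr]
  · have h1 := hAB.trans (volume_mul_le_of_isBilipschitzOn hΛ hA hB hf)
    have h2 : f '' ParabolicPlane.box A B ∩ (E ∩ Metric.ball p r) = f '' ParabolicPlane.box A B := by
      refine inter_eq_left.2 ?_
      rintro _ ⟨v, hv, rfl⟩
      exact hfE v hv
    rw [h2]
    rw [mul_assoc, ENNReal.ofReal_mul (by positivity)] at h1
    have h3 : ENNReal.ofReal (Λ ^ 3) ≠ 0 := by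
      rw [Ne, ENNReal.ofReal_eq_zero, not_le]; positivity
    exact (ENNReal.mul_le_mul_iff_right h3 ENNReal.ofReal_ne_top).1 h1

end Heis

/-! ### Big pieces of the graph at all scales. -/

namespace Heis

variable {φ : ℝ × ℝ → ℝ}

/-- The bilipschitz constant of the charts of an intrinsic `L`-Lipschitz graph. -/
noncomputable def chartConst (L : ℝ) : ℝ := 18 * (1 + L) * (2 * L + 2)

/-- The radius of a ball containing the chart at scale `1`. -/
noncomputable def chartRadius (L : ℝ) : ℝ := 8 * (1 + L) * (2 * L + 2)

theorem hasBigPiece_of_verticalDecay {L s q : ℝ} (hL : 0 < L)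
    (h : ∀ w w', |φ w - φ w'| ≤ L * slopeDist φ w w') (hs : 0 < s) (hq : 0 < q) (hq1 : q < 1)
    (hv : VerticalDecay (2 * L) s ((1 - q) / 40) q φ) (w₀ : ℝ × ℝ) :
    HasBigPiece (intrinsicGraph φ) (chartConst L) (1 / (16 * chartConst L ^ 3 * chartRadius L ^ 3))
      (graphMap φ w₀) (chartRadius L * s) := by
  set M := 2 * L + 2 with hM
  have hM2 : 2 ≤ M := by linarith
  have hφ := intrinsicBound_of_slopeDist hL.le h
  -- Both hypotheses on `φ` involve only coordinate differences, so ordinary translation of `ℝ²` may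
  -- move `w₀` to the origin.
  set ψ : ℝ × ℝ → ℝ := fun w => φ (w₀.1 + w.1, w₀.2 + w.2) with hψ
  have hψb : IntrinsicBound (2 * L) ψ := hφ.translate w₀.1 w₀.2
  have hψv : VerticalDecay (2 * L) s ((1 - q) / 40) q ψ := fun n y t t' htt =>
    hv n (w₀.1 + y) (w₀.2 + t) (w₀.2 + t') (by rwa [add_sub_add_left_eq_sub])
  obtain ⟨T, hT0, hT⟩ := exists_height_cantorCore hs (by linarith) hψb hψv hq hq1 (by linarith)
    (by linarith)
  set A := cantorCore s 2 ((1 - q) / 40) q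
  set B := cantorCore (s ^ 2) 4 ((1 - q) / 40) q
  set pt : ParabolicPlane → ℝ × ℝ := fun v => (w₀.1 + v.y, w₀.2 + T v.y v.t) with hpt
  have hslope : ∀ v v', slopeDist φ (pt v) (pt v')
      = koranyi ⟨0, v.y - v'.y, T v.y v.t - T v'.y v'.t - ψ (v'.y, T v'.y v'.t) * (v.y - v'.y)⟩ := by
    intro v v'
    simp only [slopeDist, hpt, hψ, add_sub_add_left_eq_sub]
  have hC1 : 1 ≤ chartConst L := by unfold chartConst; nlinarith
  have hR8 : 8 ≤ chartRadius L := by unfold chartRadius; nlinarith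
  have hR0 : 0 < chartRadius L := by linarith
  have hC0 : 0 < chartConst L := by linarith
  -- With this `c` the box has scale `c r = 2 s`, and `(2 s)² / 16` is precisely the bound `s² / 4`
  -- on the parameters `τ`.
  refine HasBigPiece.of_box (c := 2 / chartRadius L) (A := A) (B := B)
    (f := fun v => graphMap φ (pt v)) hC1 (by positivity) (by positivity) ?_
    (isClosed_cantorCore _ _ _ _) (isClosed_cantorCore _ _ _ _) ?_ ?_ ?_ ?_ ?_
  · rw [← mul_div_assoc, div_le_one hR0]; linarith
  · intro y hy
    have e : 2 / chartRadius L * (chartRadius L * s) = 2 * s := by field_simp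
    rw [e]; linarith [hy.1]
  · intro τ hτ
    have e : 2 / chartRadius L * (chartRadius L * s) = 2 * s := by field_simp
    rw [e]; linarith [hτ.1]
  · have h1 := le_volume_cantorCore (S := s) (M := 2) (κ := (1 - q) / 40) hs (by norm_num) hq hq1
      (by linarith) (by linarith)
    have h2 := le_volume_cantorCore (S := s ^ 2) (M := 4) (κ := (1 - q) / 40) (by positivity)
      (by norm_num) hq hq1 (by linarith) (by linarith)
    refine le_trans (le_of_eq ?_) (mul_le_mul' h1 h2)
    rw [← ENNReal.ofReal_mul (by positivity)]
    congr 1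
    field_simp
    ring
  · intro v hv v' hv'
    have hp := hT v.y hv.1 v.t hv.2 v'.y hv'.1 v'.t hv'.2
    obtain ⟨h1, h2⟩ := koranyi_comparison (by linarith : 1 ≤ M) hp
    rw [← hslope, ← ParabolicPlane.dist_eq_koranyi] at h1 h2
    have h3 := slopeDist_le_two_mul_dist φ (pt v) (pt v')
    have h4 := dist_graphMap_le h (pt v) (pt v')
    have hd : 0 ≤ dist (graphMap φ (pt v)) (graphMap φ (pt v')) := dist_nonneg
    have hd' : 0 ≤ dist v v' := dist_nonneg
    constructor
    · rw [inv_mul_le_iff₀ hC0]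
      calc dist v v' ≤ 9 * M * (2 * dist (graphMap φ (pt v)) (graphMap φ (pt v'))) :=
            h2.trans (mul_le_mul_of_nonneg_left h3 (by linarith))
        _ = 18 * 1 * M * dist (graphMap φ (pt v)) (graphMap φ (pt v')) := by ring
        _ ≤ 18 * (1 + L) * M * dist (graphMap φ (pt v)) (graphMap φ (pt v')) := by
            gcongr; linarith
    · calc _ ≤ (1 + L) * (9 * M * dist v v') :=
            h4.trans (mul_le_mul_of_nonneg_left h1 (by linarith))
        _ = (9 * (1 + L) * M) * dist v v' := by ring
        _ ≤ 18 * (1 + L) * M * dist v v' := by gcongr; norm_num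
  · intro v hv
    refine ⟨mem_range_self _, ?_⟩
    have h4 := dist_graphMap_le h (pt v) w₀
    have hp := hT0 v.y hv.1 v.t hv.2
    have e : slopeDist φ (pt v) w₀ = koranyi ⟨0, v.y, T v.y v.t - ψ (0, 0) * v.y⟩ := by
      simp [slopeDist, hpt, hψ]
    have h1 : |T v.y v.t - ψ (0, 0) * v.y| ≤ (M * s) ^ 2 := by
      have := abs_add_le (T v.y v.t - ψ (0, 0) * v.y - v.t) v.t
      rw [sub_add_cancel] at this
      have h3 := hv.2.1
      nlinarith [sq_nonneg s]
    have h2 := koranyi_le_add v.y (T v.y v.t - ψ (0, 0) * v.y)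
    have h3 : √|T v.y v.t - ψ (0, 0) * v.y| ≤ M * s := by
      rw [← Real.sqrt_sq (by positivity : 0 ≤ M * s)]
      exact Real.sqrt_le_sqrt h1
    have h5 : slopeDist φ (pt v) w₀ ≤ 3 * M * s := by
      rw [e]; nlinarith [hv.1.1]
    rw [Metric.mem_ball]
    calc _ ≤ (1 + L) * (3 * M * s) := h4.trans (mul_le_mul_of_nonneg_left h5 (by linarith))
      _ < 8 * ((1 + L) * M * s) := by
          have : 0 < (1 + L) * M * s := by positivity
          nlinarith
      _ = chartRadius L * s := by unfold chartRadius; rw [← hM]; ring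

/-- Oscillation at vertical scale `r²` is of order `r ^ (1 + α)`. For `r = s / 2 ^ n` the surplus `r
^ α` is `s ^ α (q ^ n) ^ 2` when `q = 2 ^ (-α / 2)`, and small `s` beats the constants. -/
theorem HasExtraVerticalHolder.exists_verticalDecay {α H L : ℝ} (hα : 0 < α) (hH : 0 < H)
    (hL : 0 ≤ L) (h : HasExtraVerticalHolder φ α H) :
    ∃ q s₀ : ℝ, 0 < q ∧ q < 1 ∧ 0 < s₀ ∧
      ∀ s, 0 < s → s ≤ s₀ → VerticalDecay L s ((1 - q) / 40) q φ := by
  set q : ℝ := (2 : ℝ) ^ (-(α / 2)) with hq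
  have hq0 : 0 < q := Real.rpow_pos_of_pos two_pos _
  have hq1 : q < 1 := Real.rpow_lt_one_of_one_lt_of_neg one_lt_two (by linarith)
  set κ := (1 - q) / 40 with hκ
  have hκ0 : 0 < κ := by rw [hκ]; linarith
  have hG : 0 < IntrinsicBound.spread L := by unfold IntrinsicBound.spread; positivity
  set G := IntrinsicBound.spread L
  set D := H * G ^ ((1 + α) / 2) with hD
  have hD0 : 0 < D := mul_pos hH (Real.rpow_pos_of_pos hG _)
  refine ⟨q, (κ ^ 2 / 5 / D) ^ α⁻¹, hq0, hq1, by positivity, fun s hs hs0 n y t t' htt => ?_⟩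
  have hsα : D * s ^ α ≤ κ ^ 2 / 5 := by
    have h1 : s ^ α ≤ ((κ ^ 2 / 5 / D) ^ α⁻¹) ^ α := Real.rpow_le_rpow hs.le hs0 hα.le
    rw [← Real.rpow_mul (by positivity), inv_mul_cancel₀ hα.ne', Real.rpow_one,
      le_div_iff₀ hD0] at h1
    linarith
  have hr0 : 0 < s / 2 ^ n := by positivity
  have hrα : (s / 2 ^ n) ^ α = s ^ α * (q ^ n) ^ 2 := by
    rw [Real.div_rpow hs.le (by positivity), hq, ← Real.rpow_natCast 2 n, ← Real.rpow_mul (by norm_num),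
      ← Real.rpow_natCast _ n, ← Real.rpow_mul (by norm_num), ← Real.rpow_natCast _ 2,
      ← Real.rpow_mul (by norm_num), div_eq_mul_inv, ← Real.rpow_neg (by norm_num)]
    congr 2
    push_cast; ring
  calc |φ (y, t) - φ (y, t')| ≤ H * |t - t'| ^ ((1 + α) / 2) := h y t t'
    _ ≤ H * (G * (s / 2 ^ n) ^ 2) ^ ((1 + α) / 2) := by
        gcongr
    _ = D * (s / 2 ^ n) ^ α * (s / 2 ^ n) := by
        rw [Real.mul_rpow hG.le (by positivity), ← Real.rpow_natCast _ 2, ← Real.rpow_mul hr0.le,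
          show ((2 : ℕ) : ℝ) * ((1 + α) / 2) = α + 1 by push_cast; ring, Real.rpow_add_one hr0.ne']
        ring
    _ = D * s ^ α * (q ^ n) ^ 2 * (s / 2 ^ n) := by rw [hrα]; ring
    _ ≤ κ ^ 2 / 5 * (q ^ n) ^ 2 * (s / 2 ^ n) := by gcongr

/-- Far from the support, the graph is a vertical plane. -/
theorem hasBigPiece_of_large {R M r : ℝ} (hM : ∀ w, |φ w| ≤ M)
    (hR : ∀ y t, R < |y| → φ (y, t) = 0) (hr : 0 < r) (hRr : 16 * R ≤ r) (hMr : 16 * M ≤ r)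
    (w₀ : ℝ × ℝ) :
    HasBigPiece (intrinsicGraph φ) 1 (1 / 16384) (graphMap φ w₀) r := by
  -- Move away from the origin in `y`: the strip of half-width `r / 16` about `y₁` misses the
  -- support, for every `t`, yet stays within `r / 4` of `w₀.1`.
  obtain ⟨y₁, hy₁, hy₂⟩ : ∃ y₁ : ℝ, |y₁ - w₀.1| = 3 * r / 16 ∧ 3 * r / 16 ≤ |y₁| := by
    rcases le_total 0 w₀.1 with h0 | h0
    · refine ⟨w₀.1 + 3 * r / 16, ?_, ?_⟩
      · rw [add_sub_cancel_left, abs_of_nonneg (by positivity)]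
      · rw [abs_of_nonneg (by positivity)]; linarith
    · refine ⟨w₀.1 - 3 * r / 16, ?_, ?_⟩
      · rw [sub_sub_cancel_left, abs_neg, abs_of_nonneg (by positivity)]
      · rw [abs_of_nonpos (by linarith)]; linarith
  -- Following the slope at `w₀` keeps the box in the ball about `Φ w₀` even when `w₀` is in the
  -- support.
  set t₁ := w₀.2 + φ w₀ * (y₁ - w₀.1) with ht₁
  have hzero : ∀ y t, |y| ≤ r / 16 → φ (y₁ + y, t₁ + t) = 0 := by
    intro y t hy
    apply hR
    have := abs_sub_abs_le_abs_sub y₁ (-y)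
    rw [abs_neg, sub_neg_eq_add] at this
    linarith
  refine HasBigPiece.of_box (c := 1 / 16) (A := Icc (-(r / 16)) (r / 16))
    (B := Icc (-((r / 16) ^ 2 / 16)) ((r / 16) ^ 2 / 16)) (f := fun v => graphMap φ (y₁ + v.y, t₁ + v.t))
    le_rfl hr (by norm_num) (by norm_num) isClosed_Icc isClosed_Icc ?_ ?_ ?_ ?_ ?_
  · intro y hy
    have := abs_le.2 hy
    linarith
  · intro t ht
    have := abs_le.2 ht
    rwa [one_div_mul_eq_div]
  · rw [Real.volume_Icc, Real.volume_Icc, ← ENNReal.ofReal_mul (by linarith)]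
    apply ENNReal.ofReal_le_ofReal
    apply le_of_eq; ring
  · intro v hv v' hv'
    have e : dist (graphMap φ (y₁ + v.y, t₁ + v.t)) (graphMap φ (y₁ + v'.y, t₁ + v'.t))
        = dist v v' := by
      rw [ParabolicPlane.dist_eq_koranyi, dist_eq, graphMap_eq, graphMap_eq,
        hzero _ _ (abs_le.2 hv.1), hzero _ _ (abs_le.2 hv'.1)]
      congr 1
      ext <;> simp <;> ring
    rw [e]; simp
  · intro v hv
    refine ⟨mem_range_self _, ?_⟩
    have hy := abs_le.2 hv.1
    have ht := abs_le.2 hv.2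
    rw [Metric.mem_ball, dist_eq]
    refine (koranyi_le_projW_add _).trans_lt ?_
    rw [inv_graphMap_mul_x, projW_inv_graphMap_mul, hzero _ _ hy, zero_sub, abs_neg]
    refine lt_of_le_of_lt (add_le_add (koranyi_le_add _ _) (hM w₀)) ?_
    simp only
    have e1 : t₁ + v.t - w₀.2 - φ w₀ * (y₁ + v.y - w₀.1) = v.t - φ w₀ * v.y := by
      rw [ht₁]; ring
    rw [e1]
    have h1 : |y₁ + v.y - w₀.1| ≤ r / 4 := by
      rw [show y₁ + v.y - w₀.1 = (y₁ - w₀.1) + v.y by ring]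
      refine (abs_add_le _ _).trans ?_
      linarith
    have h2 : |v.t - φ w₀ * v.y| ≤ (r / 8) ^ 2 := by
      refine (abs_sub _ _).trans ?_
      rw [abs_mul]
      have : |φ w₀| * |v.y| ≤ r / 16 * (r / 16) :=
        mul_le_mul ((hM w₀).trans (by linarith)) hy (abs_nonneg _) (by positivity)
      nlinarith
    have h3 : √|v.t - φ w₀ * v.y| ≤ r / 8 := by
      rw [← Real.sqrt_sq (by positivity : 0 ≤ r / 8)]
      exact Real.sqrt_le_sqrt h2
    linarith

theorem exists_hasBigPiece {α H L : ℝ} (hsupp : HasCompactSupport φ) (hL : 0 < L)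
    (h : ∀ w w', |φ w - φ w'| ≤ L * slopeDist φ w w') (hα : 0 < α) (hH : 0 < H)
    (hHolder : HasExtraVerticalHolder φ α H) :
    ∃ Λ θ : ℝ, 1 ≤ Λ ∧ 0 < θ ∧ ∀ p ∈ intrinsicGraph φ, ∀ r : ℝ, 0 < r →
      HasBigPiece (intrinsicGraph φ) Λ θ p r := by
  obtain ⟨q, s₀, hq, hq1, hs₀, hdecay⟩ :=
    hHolder.exists_verticalDecay (L := 2 * L) hα hH (by linarith)
  have hcont := (intrinsicBound_of_slopeDist hL.le h).continuous
  obtain ⟨M, hM⟩ := hcont.bounded_above_of_compact_support hsupp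
  obtain ⟨R, hR⟩ := hsupp.isCompact.isBounded.subset_closedBall (0 : ℝ × ℝ)
  have hR' : ∀ y t, R < |y| → φ (y, t) = 0 := by
    intro y t hy
    refine image_eq_zero_of_notMem_tsupport fun hmem => ?_
    have := hR hmem
    rw [mem_closedBall_zero_iff, Prod.norm_def] at this
    have h2 := (le_max_left ‖y‖ ‖t‖).trans this
    rw [Real.norm_eq_abs] at h2
    linarith
  have hC1 : 1 ≤ chartConst L := by unfold chartConst; nlinarith
  have hR0 : 0 < chartRadius L := by unfold chartRadius; positivity
  have hC0 : 0 < chartConst L := by linarith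
  set θ₁ := 1 / (16 * chartConst L ^ 3 * chartRadius L ^ 3) with hθ₁
  have hθ₁0 : 0 < θ₁ := by positivity
  have hM0 : 0 ≤ M := (norm_nonneg _).trans (hM 0)
  set r₀ := chartRadius L * s₀ with hr₀
  have hr₀0 : 0 < r₀ := by positivity
  set R₁ := r₀ + 16 * |R| + 16 * M with hR₁
  have hR₁0 : 0 < R₁ := by positivity
  have hsmall : ∀ w₀ r, 0 < r → r ≤ r₀ →
      HasBigPiece (intrinsicGraph φ) (chartConst L) θ₁ (graphMap φ w₀) r := by
    intro w₀ r hr hrr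
    have hs : r / chartRadius L ≤ s₀ := by rw [div_le_iff₀ hR0]; linarith
    have := hasBigPiece_of_verticalDecay hL h (s := r / chartRadius L) (by positivity) hq hq1
      (hdecay _ (by positivity) hs) w₀
    rwa [mul_div_cancel₀ _ hR0.ne'] at this
  set θ₂ := θ₁ * r₀ ^ 3 / R₁ ^ 3 with hθ₂
  have hθ₂0 : 0 < θ₂ := by positivity
  refine ⟨chartConst L, min θ₁ (min θ₂ (1 / 16384)), hC1, by positivity, ?_⟩
  rintro _ ⟨w₀, rfl⟩ r hr
  rcases le_total r r₀ with h1 | h1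
  · exact (hsmall w₀ r hr h1).mono hC0 le_rfl le_rfl
      (mul_le_mul_of_nonneg_right (min_le_left _ _) (by positivity))
  rcases le_total r R₁ with h2 | h2
  -- Intermediate radii reuse the piece at scale `r₀`, losing the bounded factor `(R₁ / r₀) ^ 3`.
  · refine (hsmall w₀ r₀ hr₀0 le_rfl).mono hC0 le_rfl h1 ?_
    calc _ ≤ θ₂ * R₁ ^ 3 := by
          gcongr
          exact (min_le_right _ _).trans (min_le_left _ _)
      _ = θ₁ * r₀ ^ 3 := by rw [hθ₂]; field_simp
  · refine (hasBigPiece_of_large (fun w => hM w) hR' hr ?_ ?_ w₀).mono one_pos hC1 le_rfl ?_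
    · linarith [le_abs_self R]
    · linarith [abs_nonneg R]
    · gcongr
      exact (min_le_right _ _).trans (min_le_right _ _)

end Heis

/-! ### Upper regularity by covering. -/

namespace Heis

variable {φ : ℝ × ℝ → ℝ}

/-- The centers of a covering of the part of the graph in the ball of radius `n δ` about
`graphMap φ w₀` by balls of radius comparable with `δ`. -/
noncomputable def coverCenter (φ : ℝ × ℝ → ℝ) (w₀ : ℝ × ℝ) (δ : ℝ) (k : ℤ × ℤ) : ℝ × ℝ :=
  (w₀.1 + k.1 * δ, w₀.2 + φ w₀ * (k.1 * δ) + k.2 * δ ^ 2)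

theorem exists_coverCenter {L δ : ℝ} {n : ℕ} (hL : 0 ≤ L)
    (h : ∀ w w', |φ w - φ w'| ≤ L * slopeDist φ w w') (hδ : 0 < δ) (hn : 1 ≤ n) (w w₀ : ℝ × ℝ)
    (hw : dist (graphMap φ w) (graphMap φ w₀) < n * δ) :
    ∃ k ∈ Finset.Icc (-(n : ℤ)) n ×ˢ Finset.Icc (-(2 * (n : ℤ) ^ 2)) (2 * (n : ℤ) ^ 2),
      dist (graphMap φ (coverCenter φ w₀ δ k)) (graphMap φ w) ≤ 3 * (1 + L) * δ := by
  have hn1 : (1 : ℝ) ≤ n := by exact_mod_cast hn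
  set r := n * δ with hr
  have hδr : δ ≤ r := by nlinarith
  have hx : |φ w - φ w₀| ≤ r := by
    have := abs_sub_x_le_dist (graphMap φ w) (graphMap φ w₀)
    simp only [graphMap_eq φ w, graphMap_eq φ w₀] at this
    rw [← graphMap_eq, ← graphMap_eq] at this
    exact this.trans hw.le
  have hy : |w.1 - w₀.1| < r := by
    have := abs_sub_y_le_dist (graphMap φ w) (graphMap φ w₀)
    simp only [graphMap_eq φ w, graphMap_eq φ w₀] at this
    rw [← graphMap_eq, ← graphMap_eq] at this
    exact this.trans_lt hw
  have hX : |w.2 - w₀.2 - φ w₀ * (w.1 - w₀.1)| ≤ r ^ 2 := by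
    have h1 := (slopeDist_le_two_mul_dist φ w w₀).trans (by linarith : _ ≤ 2 * r)
    have h2 := four_mul_abs_t_le_koranyi_sq
      ⟨0, w.1 - w₀.1, w.2 - w₀.2 - φ w₀ * (w.1 - w₀.1)⟩
    have h3 := pow_le_pow_left₀ (slopeDist_nonneg φ w w₀) h1 2
    unfold slopeDist at h3
    simp only at h2
    nlinarith
  set i := ⌊(w.1 - w₀.1) / δ⌋ with hi
  have hi1 : i * δ ≤ w.1 - w₀.1 := by
    rw [← le_div_iff₀ hδ]; exact Int.floor_le _
  have hi2 : w.1 - w₀.1 < (i + 1) * δ := by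
    rw [← div_lt_iff₀ hδ]; exact Int.lt_floor_add_one _
  set X := w.2 - w₀.2 - φ w₀ * (w.1 - w₀.1) with hXdef
  -- The grid follows the slope at `w₀`, but distances to `w` are read with the slope at `w`. `Z`
  -- includes this change of slope, which adds at most `r δ ≤ r²`; hence the vertical index range `2
  -- n²`.
  set Z := X + (φ w - φ w₀) * (w₀.1 + i * δ - w.1) with hZ
  have hZr : |Z| ≤ 2 * r ^ 2 := by
    refine (abs_add_le _ _).trans ?_
    rw [abs_mul]
    have h1 : |w₀.1 + i * δ - w.1| ≤ δ := by rw [abs_le]; constructor <;> linarith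
    have h2 : |φ w - φ w₀| * |w₀.1 + i * δ - w.1| ≤ r * δ :=
      mul_le_mul hx h1 (abs_nonneg _) (by linarith)
    nlinarith
  have hδ2 : 0 < δ ^ 2 := by positivity
  set j := ⌊Z / δ ^ 2⌋ with hj
  have hj1 : j * δ ^ 2 ≤ Z := by
    rw [← le_div_iff₀ hδ2]; exact Int.floor_le _
  have hj2 : Z < (j + 1) * δ ^ 2 := by
    rw [← div_lt_iff₀ hδ2]; exact Int.lt_floor_add_one _
  have hr2 : r ^ 2 = n ^ 2 * δ ^ 2 := by rw [hr]; ring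
  refine ⟨(i, j), ?_, ?_⟩
  · rw [abs_lt] at hy
    rw [abs_le] at hZr
    rw [Finset.mem_product, Finset.mem_Icc, Finset.mem_Icc]
    refine ⟨⟨?_, ?_⟩, ?_, ?_⟩
    · refine Int.le_floor.2 ?_
      rw [le_div_iff₀ hδ]; push_cast; linarith
    · have : (i : ℝ) ≤ n := le_of_mul_le_mul_right (by linarith : (i : ℝ) * δ ≤ n * δ) hδ
      exact_mod_cast this
    · refine Int.le_floor.2 ?_
      rw [le_div_iff₀ hδ2]; push_cast; linarith
    · have : (j : ℝ) ≤ 2 * n ^ 2 := le_of_mul_le_mul_right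
        (by linarith : (j : ℝ) * δ ^ 2 ≤ 2 * n ^ 2 * δ ^ 2) hδ2
      exact_mod_cast this
  · have h1 := dist_graphMap_le h (coverCenter φ w₀ δ (i, j)) w
    have h2 : slopeDist φ (coverCenter φ w₀ δ (i, j)) w ≤ 3 * δ := by
      refine (koranyi_le_add _ _).trans ?_
      have e : (coverCenter φ w₀ δ (i, j)).2 - w.2 - φ w * ((coverCenter φ w₀ δ (i, j)).1 - w.1)
          = j * δ ^ 2 - Z := by
        simp only [coverCenter, hZ, hXdef]; ring
      have h3 : |(coverCenter φ w₀ δ (i, j)).1 - w.1| ≤ δ := by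
        simp only [coverCenter]
        rw [abs_le]; constructor <;> linarith
      have h4 : √|(j : ℝ) * δ ^ 2 - Z| ≤ δ := by
        rw [← Real.sqrt_sq hδ.le]
        refine Real.sqrt_le_sqrt ?_
        rw [abs_le, Real.sqrt_sq hδ.le]; constructor <;> linarith
      rw [e]; linarith
    refine h1.trans ?_
    nlinarith

/-- Of order `n³` balls of radius of order `r / n` suffice, so the sum of cubed diameters is bounded
independently of `n`. -/
theorem hausdorffMeasure_intrinsicGraph_inter_ball_le {L r : ℝ} (hL : 0 ≤ L)
    (h : ∀ w w', |φ w - φ w'| ≤ L * slopeDist φ w w') (hr : 0 < r) {p : Heis}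
    (hp : p ∈ intrinsicGraph φ) :
    μH[3] (intrinsicGraph φ ∩ Metric.ball p r)
      ≤ ENNReal.ofReal (15 * (6 * (1 + L)) ^ 3 * r ^ 3) := by
  obtain ⟨w₀, rfl⟩ := hp
  set I : ℕ → Finset (ℤ × ℤ) := fun n =>
    Finset.Icc (-(n : ℤ)) n ×ˢ Finset.Icc (-(2 * (n : ℤ) ^ 2)) (2 * (n : ℤ) ^ 2)
  set t : ∀ n : ℕ, I n → Set Heis := fun n k =>
    Metric.closedBall (graphMap φ (coverCenter φ w₀ (r / n) k)) (3 * (1 + L) * (r / n))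
  set ρ : ℕ → ℝ≥0∞ := fun n => ENNReal.ofReal (6 * (1 + L) * (r / n)) with hρ
  have hρ0 : Tendsto ρ atTop (𝓝 0) := by
    have h1 : Tendsto (fun n : ℕ => 6 * (1 + L) * (r / n)) atTop (𝓝 (6 * (1 + L) * 0)) :=
      (tendsto_const_div_atTop_nhds_zero_nat r).const_mul _
    rw [mul_zero] at h1
    have := ENNReal.tendsto_ofReal h1
    rwa [ENNReal.ofReal_zero] at this
  have hdiam : ∀ n k, Metric.ediam (t n k) ≤ ρ n := by
    intro n k
    have h0 : 0 ≤ r / n := by positivity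
    have h0' : 0 ≤ 3 * (1 + L) * (r / n) := by positivity
    refine Metric.ediam_le_of_forall_dist_le fun x hx y hy => ?_
    have hx' := Metric.mem_closedBall.1 hx
    have hy' := Metric.mem_closedBall'.1 hy
    have := dist_triangle x (graphMap φ (coverCenter φ w₀ (r / n) k)) y
    linarith
  have hcov : ∀ᶠ n : ℕ in atTop,
      intrinsicGraph φ ∩ Metric.ball (graphMap φ w₀) r ⊆ ⋃ k, t n k := by
    filter_upwards [eventually_ge_atTop 1] with n hn
    have hn0 : (0 : ℝ) < n := by exact_mod_cast hn
    rintro _ ⟨⟨w, rfl⟩, hw⟩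
    obtain ⟨k, hk, hkw⟩ := exists_coverCenter hL h (δ := r / n) (by positivity) hn w w₀
      (by rw [mul_div_cancel₀ _ hn0.ne']; exact hw)
    exact mem_iUnion.2 ⟨⟨k, hk⟩, Metric.mem_closedBall'.2 hkw⟩
  refine (Measure.hausdorffMeasure_le_liminf_sum 3 _ ρ hρ0 t
    (Eventually.of_forall fun n k => hdiam n k) hcov).trans ?_
  have hconst : ∀ᶠ n : ℕ in atTop, ∑ k, Metric.ediam (t n k) ^ (3 : ℝ)
      ≤ ENNReal.ofReal (15 * (6 * (1 + L)) ^ 3 * r ^ 3) := by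
    filter_upwards [eventually_ge_atTop 1] with n hn
    have hn1 : (1 : ℝ) ≤ n := by exact_mod_cast hn
    have hcard : ((I n).card : ℝ) ≤ 15 * n ^ 3 := by
      have e1 : ((((n : ℤ) + 1 - -(n : ℤ)).toNat : ℕ) : ℤ) = 2 * n + 1 := by omega
      have e2 : (((2 * (n : ℤ) ^ 2 + 1 - -(2 * (n : ℤ) ^ 2)).toNat : ℕ) : ℤ) = 4 * n ^ 2 + 1 := by
        have : 0 ≤ (n : ℤ) ^ 2 := by positivity
        omega
      have e3 : ((I n).card : ℝ) = (2 * n + 1) * (4 * n ^ 2 + 1) := by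
        rw [Finset.card_product, Int.card_Icc, Int.card_Icc]
        have : (((((n : ℤ) + 1 - -(n : ℤ)).toNat *
          (2 * (n : ℤ) ^ 2 + 1 - -(2 * (n : ℤ) ^ 2)).toNat : ℕ) : ℤ) : ℝ)
          = ((2 * n + 1) * (4 * n ^ 2 + 1) : ℤ) := by
          rw [Nat.cast_mul, e1, e2]
        push_cast at this ⊢
        exact this
      have h2 : (n : ℝ) ≤ n ^ 2 := by nlinarith
      rw [e3]
      calc (2 * (n : ℝ) + 1) * (4 * (n : ℝ) ^ 2 + 1) ≤ (3 * n) * (5 * (n : ℝ) ^ 2) := by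
            apply mul_le_mul <;> nlinarith
        _ = 15 * (n : ℝ) ^ 3 := by ring
    calc ∑ k, Metric.ediam (t n k) ^ (3 : ℝ) ≤ ∑ k : I n, ρ n ^ (3 : ℝ) :=
          Finset.sum_le_sum fun k _ => ENNReal.rpow_le_rpow (hdiam n k) (by norm_num)
      _ = ENNReal.ofReal ((I n).card * (6 * (1 + L) * (r / n)) ^ 3) := by
          rw [Finset.sum_const, Finset.card_univ, Fintype.card_coe, nsmul_eq_mul, hρ,
            ENNReal.ofReal_rpow_of_nonneg (by positivity) (by norm_num),
            show (3 : ℝ) = ((3 : ℕ) : ℝ) by norm_num, Real.rpow_natCast,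
            ENNReal.ofReal_mul (by positivity), ENNReal.ofReal_natCast]
      _ ≤ _ := by
          apply ENNReal.ofReal_le_ofReal
          calc _ ≤ 15 * (n : ℝ) ^ 3 * (6 * (1 + L) * (r / n)) ^ 3 := by gcongr
            _ = _ := by field_simp
  refine (liminf_le_liminf hconst).trans ?_
  simp

end Heis

/-! ### Rectifiability from big pieces. -/

namespace Heis

/-- A closed set which is upper `3`-regular and has big pieces of bilipschitz images of the
parabolic plane at all its points and scales is LI rectifiable. -/
theorem isLIRectifiable_of_hasBigPiece {E : Set Heis} (hE : IsClosed E) (hne : E.Nonempty)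
    {C Λ θ : ℝ} (hC : 0 < C) (hΛ : 1 ≤ Λ) (hθ : 0 < θ)
    (hup : ∀ p ∈ E, ∀ r : ℝ, 0 < r → μH[3] (E ∩ Metric.ball p r) ≤ ENNReal.ofReal (C * r ^ 3))
    (hbig : ∀ p ∈ E, ∀ r : ℝ, 0 < r → HasBigPiece E Λ θ p r) : IsLIRectifiable E := by
  refine ⟨le_toOuterMeasure_caratheodory _ _ hE.measurableSet, ?_⟩
  have : Nonempty E := hne.to_subtype
  set d : ℕ → E := TopologicalSpace.denseSeq E
  have hδ : ∀ n : ℕ, (0 : ℝ) < 1 / (n + 1) := fun n => by positivity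
  -- Only charts at centers `d m` and radii `1 / (n + 1)` are used, which keeps the family
  -- countable.
  choose K f hK hKr hf hm using fun m n : ℕ => hbig (d m) (d m).2 (1 / (n + 1)) (hδ n)
  set g : ℕ → ℕ → Heis → Heis := fun m n p => f m n ⟨p.y, p.t⟩ with hg
  have hgK : ∀ m n, g m n '' (ParabolicPlane.toHeis '' K m n) = f m n '' K m n := by
    intro m n
    rw [image_image]
    exact image_congr fun v _ => rfl
  have hcomp : ∀ m n, IsCompact (f m n '' K m n) := by
    intro m n
    refine (hK m n).image_of_continuousOn ?_
    have : LipschitzOnWith (Real.toNNReal Λ) (f m n) (K m n) :=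
      LipschitzOnWith.of_dist_le_mul fun v hv w hw => by
        rw [Real.coe_toNNReal _ (by linarith)]; exact (hf m n v hv w hw).2
    exact this.continuousOn
  refine ⟨fun i => ParabolicPlane.toHeis '' K i.unpair.1 i.unpair.2,
    fun i => g i.unpair.1 i.unpair.2, fun i => ⟨?_, ?_, Real.toNNReal Λ, ?_⟩, ?_⟩
  · exact ((hK _ _).image ParabolicPlane.isometry_toHeis.continuous).isClosed
  · refine ⟨{p | 1 * p.x + 0 * p.y = 0}, ⟨1, 0, Or.inl one_ne_zero, rfl⟩, ?_⟩
    rintro _ ⟨v, -, rfl⟩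
    simp [ParabolicPlane.toHeis]
  · refine LipschitzOnWith.of_dist_le_mul ?_
    rintro _ ⟨v, hv, rfl⟩ _ ⟨w, hw, rfl⟩
    rw [Real.coe_toNNReal _ (by linarith), ParabolicPlane.isometry_toHeis.dist_eq]
    exact (hf _ _ v hv w hw).2
  set V : Set Heis := ⋃ i : ℕ, g i.unpair.1 i.unpair.2 ''
    (ParabolicPlane.toHeis '' K i.unpair.1 i.unpair.2) with hV
  have hfV : ∀ m n, f m n '' K m n ⊆ V := by
    intro m n
    rw [← hgK]
    refine subset_iUnion_of_subset (Nat.pair m n) ?_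
    rw [Nat.unpair_pair]
  set μ : Measure E := μH[3] with hμ
  have hiso : Isometry ((↑) : E → Heis) := isometry_subtype_coe
  have hμimg : ∀ s : Set E, μ s = μH[3] (((↑) : E → Heis) '' s) := fun s =>
    (hiso.hausdorffMeasure_image (Or.inl (by norm_num)) s).symm
  have hball : ∀ (x : E) (r : ℝ), ((↑) : E → Heis) '' Metric.closedBall x r
      = E ∩ Metric.closedBall (x : Heis) r := by
    intro x r
    ext p
    constructor
    · rintro ⟨y, hy, rfl⟩; exact ⟨y.2, hy⟩
    · rintro ⟨hp, hpr⟩; exact ⟨⟨p, hp⟩, hpr, rfl⟩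
  have hcup : ∀ (x : E) (r : ℝ), 0 < r →
      μ (Metric.closedBall x r) ≤ ENNReal.ofReal (8 * C * r ^ 3) := by
    intro x r hr
    rw [hμimg, hball]
    refine (measure_mono (inter_subset_inter_right _
      (Metric.closedBall_subset_ball (by linarith : r < 2 * r)))).trans
      ((hup x x.2 (2 * r) (by linarith)).trans (le_of_eq ?_))
    congr 1; ring
  have hclow : ∀ (x : E) (r : ℝ), 0 < r →
      ENNReal.ofReal (θ * r ^ 3) ≤ μ (Metric.closedBall x r) := by
    intro x r hr
    obtain ⟨K', f', -, -, -, h4⟩ := hbig x x.2 r hr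
    rw [hμimg, hball]
    exact h4.trans (measure_mono (inter_subset_right.trans
      (inter_subset_inter_right _ Metric.ball_subset_closedBall)))
  have hdoub : IsUnifLocDoublingMeasure μ := by
    refine ⟨⟨Real.toNNReal (64 * C / θ), ?_⟩⟩
    filter_upwards [self_mem_nhdsWithin] with ε hε x
    have hε0 : 0 < ε := hε
    calc _ ≤ ENNReal.ofReal (8 * C * (2 * ε) ^ 3) := hcup x (2 * ε) (by positivity)
      _ = ENNReal.ofReal (64 * C / θ) * ENNReal.ofReal (θ * ε ^ 3) := by
          rw [← ENNReal.ofReal_mul (by positivity)]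
          congr 1; field_simp; ring
      _ ≤ _ := mul_le_mul_right (hclow x ε hε0) _
  have hfin : IsLocallyFiniteMeasure μ :=
    ⟨fun x => ⟨Metric.closedBall x 1, Metric.closedBall_mem_nhds x one_pos,
      (hcup x 1 one_pos).trans_lt ENNReal.ofReal_lt_top⟩⟩
  set U : Set E := {x | (x : Heis) ∉ V} with hU
  have hUimg : ((↑) : E → Heis) '' U = E \ V := by
    ext p
    constructor
    · rintro ⟨x, hx, rfl⟩; exact ⟨x.2, hx⟩
    · rintro ⟨hp, hpV⟩; exact ⟨⟨p, hp⟩, hpV, rfl⟩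
  rw [← hUimg, ← hμimg, ← Measure.restrict_apply_self μ U]
  -- Density along balls that contain the point but need not be centered at it, as the charts live
  -- in balls about the dense sequence.
  have hdens := IsUnifLocDoublingMeasure.ae_tendsto_measure_inter_div μ U 1
  rw [ae_iff] at hdens
  refine measure_mono_null ?_ hdens
  intro x _
  rw [mem_ofPred_eq]
  intro hx
  have hclose : ∀ n : ℕ, ∃ m, x ∈ Metric.closedBall (d m) (1 * (1 / ((n : ℝ) + 1))) := by
    intro n
    obtain ⟨m, hm⟩ :=
      (TopologicalSpace.denseRange_denseSeq E).exists_dist_lt x (hδ n)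
    refine ⟨m, ?_⟩
    rw [one_mul, Metric.mem_closedBall]; exact hm.le
  choose m hmx using hclose
  have hδlim : Tendsto (fun n : ℕ => 1 / ((n : ℝ) + 1)) atTop (𝓝[>] 0) :=
    tendsto_nhdsWithin_iff.2
      ⟨tendsto_one_div_add_atTop_nhds_zero_nat, Eventually.of_forall fun n => hδ n⟩
  have hlim := hx (fun n => d (m n)) (fun n => 1 / ((n : ℝ) + 1)) hδlim (Eventually.of_forall hmx)
  set η := ENNReal.ofReal (θ / (8 * C)) with hη
  have hη0 : 0 < η := ENNReal.ofReal_pos.2 (by positivity)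
  -- The chart piece in this ball is disjoint from `U` and occupies at least the fraction `η`;
  -- letting the density tend to `1` gives `1 + η ≤ 1`.
  have hbound : ∀ n : ℕ, μ (U ∩ Metric.closedBall (d (m n)) (1 / ((n : ℝ) + 1)))
      / μ (Metric.closedBall (d (m n)) (1 / ((n : ℝ) + 1))) + η ≤ 1 := by
    intro n
    set r := 1 / ((n : ℝ) + 1) with hr
    have hr0 : 0 < r := hδ n
    set B := Metric.closedBall (d (m n)) r with hB
    set P := f (m n) n '' K (m n) n ∩ (E ∩ Metric.ball (d (m n) : Heis) r) with hP
    have hPm : MeasurableSet P := (hcomp _ _).isClosed.measurableSet.inter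
      (hE.measurableSet.inter Metric.isOpen_ball.measurableSet)
    have hc0 : μ B ≠ 0 := by
      refine (lt_of_lt_of_le ?_ (hclow (d (m n)) r hr0)).ne'
      exact ENNReal.ofReal_pos.2 (by positivity)
    have hct : μ B ≠ ∞ := ne_top_of_le_ne_top ENNReal.ofReal_ne_top (hcup (d (m n)) r hr0)
    have hPlow : η * μ B ≤ μH[3] P := by
      refine le_trans ?_ (hm (m n) n)
      calc η * μ B ≤ η * ENNReal.ofReal (8 * C * r ^ 3) :=
            mul_le_mul_right (hcup (d (m n)) r hr0) _
        _ = ENNReal.ofReal (θ * r ^ 3) := by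
            rw [hη, ← ENNReal.ofReal_mul (by positivity)]
            congr 1; field_simp
    have hsum : μ (U ∩ B) + μH[3] P ≤ μ B := by
      rw [hμimg (U ∩ B), hμimg B, ← measure_union _ hPm]
      · apply measure_mono
        rw [hball]
        rintro p (⟨x, hx, rfl⟩ | hp)
        · exact ⟨x.2, hx.2⟩
        · exact ⟨hp.2.1, Metric.ball_subset_closedBall hp.2.2⟩
      · rw [Set.disjoint_left]
        rintro _ ⟨x, hx, rfl⟩ hxP
        exact hx.1 (hfV _ _ hxP.1)
    rw [← ENNReal.mul_div_cancel_right (a := η) hc0 hct, ← ENNReal.add_div]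
    refine ENNReal.div_le_of_le_mul ?_
    rw [one_mul]
    exact (add_le_add_right hPlow _).trans hsum
  have hlim2 := le_of_tendsto' (hlim.add_const η) hbound
  exact absurd hlim2 (not_le.2 (ENNReal.lt_add_right ENNReal.one_ne_top hη0.ne'))

end Heis

theorem mainTheorem2 (φ : ℝ × ℝ → ℝ) (hsupp : HasCompactSupport φ)
    (hLip : Heis.IsIntrinsicLipschitz φ)
    (α H : ℝ) (hα : 0 < α) (hα1 : α ≤ 1) (hH : 0 < H)
    (hHolder : Heis.HasExtraVerticalHolder φ α H) :
    HasBigPiecesOfBilipschitzImages (Heis.intrinsicGraph φ) ∧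
      Heis.IsLIRectifiable (Heis.intrinsicGraph φ) := by
  obtain ⟨L, hL, hLL⟩ := hLip
  have h := hLL.abs_sub_le hL
  obtain ⟨Λ, θ, hΛ, hθ, hbig⟩ := Heis.exists_hasBigPiece hsupp hL h hα hH hHolder
  have hclosed := Heis.isClosed_intrinsicGraph
    (Heis.intrinsicBound_of_slopeDist hL.le h).continuous
  have hne : (Heis.intrinsicGraph φ).Nonempty := range_nonempty _
  set D := 15 * (6 * (1 + L)) ^ 3 with hD
  have hD1 : 1 ≤ D := by
    have : 1 ≤ (6 * (1 + L)) ^ 3 := one_le_pow₀ (by linarith)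
    rw [hD]; linarith
  have hup : ∀ p ∈ Heis.intrinsicGraph φ, ∀ r : ℝ, 0 < r →
      μH[3] (Heis.intrinsicGraph φ ∩ Metric.ball p r) ≤ ENNReal.ofReal (D * r ^ 3) :=
    fun p hp r hr => Heis.hausdorffMeasure_intrinsicGraph_inter_ball_le hL.le h hr hp
  refine ⟨⟨hclosed, ⟨max D θ⁻¹, hD1.trans (le_max_left _ _), fun p hp r hr _ => ⟨?_, ?_⟩⟩,
    Λ, θ, hΛ, hθ, fun p hp r hr _ => hbig p hp r hr⟩,
    Heis.isLIRectifiable_of_hasBigPiece hclosed hne (by linarith) hΛ hθ hup hbig⟩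
  -- Lower regularity is free: the big piece already has measure at least `θ r ^ 3`.
  · obtain ⟨K, f, -, -, -, hm⟩ := hbig p hp r hr
    refine (ENNReal.ofReal_le_ofReal ?_).trans (hm.trans (measure_mono inter_subset_right))
    exact mul_le_mul_of_nonneg_right (inv_le_of_inv_le₀ hθ (le_max_right _ _)) (by positivity)
  · refine (hup p hp r hr).trans (ENNReal.ofReal_le_ofReal ?_)
    exact mul_le_mul_of_nonneg_right (le_max_left _ _) (by positivity)
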